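/- **Setting.** Let $D,m\ge 1$. For $d=1,\dots,D$ let $I_d=(t_0^{(d)},T^{(d)})$ be a nonempty open interval (endpoints possibly infinite) and let $y_d$ be a centred Gaussian process on $I_d$, with $m-1$ continuous derivatives, that is a non-anticipating solution of the forward SDE $$\mathcal L_d[y_d]:=y_d^{(m)}+c_{d,m-1}(t)\,y_d^{(m-1)}+\cdots+c_{d,0}(t)\,y_d=W_d(t),\qquad t\in I_d,$$ where $W_d$ is white noise of spectrum $1$ and the $c_{d,i}$ are continuous on $I_d$; "non-anticipating" means that the state $(y_d,y_d',\dots,y_d^{(m-1)})(s)$ is independent of the noise after time $s$. Let $K_d(t,t')=\operatorname{Cov}(y_d(t),y_d(t'))$, let $\Pi_d(t)$ be the covariance matrix of the state $(y_d,\dots,y_d^{(m-1)})(t)$, and put $B=(0,\dots,0,1)^T\in\mathbb R^m$. The operator of the backward SDE of $y_d$ is $$\mathcal L_{b,d}[y]=\mathcal L_d[y]-\sum_{i=1}^{m}C_{d,i}(t)\,y^{(i-1)},\qquad (C_{d,1},\dots,C_{d,m})=B^T\Pi_d(t)^{-1}.$$ Let $\psi_{d,1},\dots,\psi_{d,m}$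 be any $m$ linearly independent solutions of $\mathcal L_d\psi=0$ on $I_d$ and $\zeta_{d,1},\dots,\zeta_{d,m}$ any $m$ linearly independent solutions of $\mathcal L_{b,d}\zeta=0$ on $I_d$. Put $$H_d=[\psi_{d,1},\dots,\psi_{d,m},\zeta_{d,1},\dots,\zeta_{d,m}],\qquad H(\mathbf x)=\bigotimes_{d=1}^D H_d(x_d)\in\mathbb R^{(2m)^D},$$ $$K(\mathbf x,\mathbf x')=\prod_{d=1}^D K_d(x_d,x_d')\quad\text{on } I=\prod_{d=1}^D I_d .$$ For points $\mathbf t_i=(t_{i,1},\dots,t_{i,D})\in I$, $i=1,\dots,n$, let $$U=\{\mathbf x\in I:\ \text{for every } d,\ x_d<\min_i t_{i,d}\ \text{or}\ x_d>\max_i t_{i,d}\}.$$ A *kernel packet (KP)* of $K$ at these points is a combination $\phi=\sum_{i=1}^{n}a_iK(\cdot,\mathbf t_i)$ with coefficients not all zero and $\phi(\mathbf x)=0$ for all $\mathbf x\in U$. **Theorem.** Let $s=(2m)^D+1$. 1. For any $s$ distinct points $\mathbf t_1,\dots,\mathbf t_s\in I$ the KP system $\sum_{i=1}^{s}a_iH(\mathbf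 t_i)=0$ has a nonzero solution. A vector $a\in\mathbb R^s$ solves this system if and only if $\sum_{i=1}^{s}a_iK(\mathbf x,\mathbf t_i)=0$ for all $\mathbf x\in U$. If $a\ne0$, then $\sum_{i}a_iK(\cdot,\mathbf t_i)$ is not identically zero on $I$. Thus the nonzero solutions give exactly the KPs at $\mathbf t_1,\dots,\mathbf t_s$. 2. The KP system is minimal, in the following senses. - $s$ is the least number $n$ such that every set of $n$ distinct points of $I$ admits a KP. - No system with fewer equations produces KPs: if $G:I\to\mathbb R^N$ is such that, for all distinct $\mathbf t_1,\dots,\mathbf t_s\in I$, every solution of $\sum_{i=1}^{s}a_iG(\mathbf t_i)=0$ satisfies $\sum_{i=1}^{s}a_iK(\cdot,\mathbf t_i)=0$ on $U$, then $N\ge(2m)^D$. - For all $(\mathbf t_1,\dots,\mathbf t_s)$ in an open dense subset of $I^s$, the KP is unique up to a scalar factor and irreducible: if $\sum_{i=1}^{s}a_iK(\cdot,\mathbf t_i)$ vanishes on $U$ and some $a_i=0$, then $a=0$. -/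

import Mathlib

open MeasureTheory ProbabilityTheory Matrix

noncomputable section

namespace KernelPacket

/-- The open time interval `(t₀, T)`, whose end points may be infinite. -/
def timeInterval (t₀ T : EReal) : Set ℝ :=
  {t : ℝ | t₀ < (t : EReal) ∧ (t : EReal) < T}

/-! ### Linear stochastic differential equations driven by white noise -/

/-- `W` is a Wiener process on the interval `I`, given through its increments: they are independent,
`W t - W s` has law `N(0, t - s)`, and the paths are almost surely continuous.  White noise of
spectrum one on `I` is the (formal) derivative of `W`. -/
structure IsWienerOn {Ω : Type*} [MeasurableSpace Ω] (I : Set ℝ) (W : ℝ → Ω → ℝ)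
    (P : Measure Ω) : Prop where
  indep_increments : HasIndepIncrements (fun t : I => W t) P
  law_increment : ∀ s ∈ I, ∀ t ∈ I, s ≤ t →
    HasLaw (fun ω => W t ω - W s ω) (gaussianReal 0 (Real.toNNReal (t - s))) P
  continuous_paths : ∀ᵐ ω ∂P, ContinuousOn (fun t => W t ω) I

/-- The state `(y, y', …, y^(m-1))` at time `t` of a process `y`. -/
def state {Ω : Type*} (m : ℕ) (y : ℝ → Ω → ℝ) (t : ℝ) (ω : Ω) (i : Fin m) : ℝ :=
  iteratedDeriv i (fun u => y u ω) t

/-- `y` is a centred Gaussian process on `I` that solves the forward stochastic differential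
equation `y^(m) + c_{m-1} y^(m-1) + ⋯ + c_0 y = dW/dt` (with `1 ≤ m`).

The equation is read in integrated form, for processes with `m - 1` continuous derivatives, and
the solution is non-anticipating: the state at time `s` is independent of the noise after
time `s`.  No condition is put on the law of the state at an initial time. -/
structure IsForwardSolution {Ω : Type*} [MeasurableSpace Ω] {m : ℕ} (I : Set ℝ)
    (c : Fin m → ℝ → ℝ) (P : Measure Ω) (W y : ℝ → Ω → ℝ) : Prop where
  wiener : IsWienerOn I W P
  gaussian : IsGaussianProcess (fun (p : I × Fin m) ω => state m y p.1 ω p.2) P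
  centered : ∀ t ∈ I, ∀ i : Fin m, ∫ ω, state m y t ω i ∂P = 0
  smooth_paths : ∀ᵐ ω ∂P, ContDiffOn ℝ ((m - 1 : ℕ) : WithTop ℕ∞) (fun t => y t ω) I
  equation : ∀ s ∈ I, ∀ t ∈ I, s ≤ t → ∀ᵐ ω ∂P,
    iteratedDeriv (m - 1) (fun u => y u ω) t - iteratedDeriv (m - 1) (fun u => y u ω) s
      + ∫ u in s..t, ∑ i : Fin m, c i u * state m y u ω i = W t ω - W s ω
  nonanticipating : ∀ s ∈ I,
    IndepFun (state m y s) (fun ω (t : {t : ℝ // t ∈ I ∧ s ≤ t}) => W t ω - W s ω) P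

/-- The covariance function `K(t, t') = Cov(y(t), y(t'))` of a process. -/
def kernel {Ω : Type*} [MeasurableSpace Ω] (P : Measure Ω) (y : ℝ → Ω → ℝ) (t t' : ℝ) : ℝ :=
  cov[y t, y t'; P]

/-- The covariance matrix `Π(t)` of the state `(y, y', …, y^(m-1))` at time `t`. -/
def stateCov {Ω : Type*} [MeasurableSpace Ω] (m : ℕ) (P : Measure Ω) (y : ℝ → Ω → ℝ) (t : ℝ) :
    Matrix (Fin m) (Fin m) ℝ :=
  Matrix.of fun i j => cov[fun ω => state m y t ω i, fun ω => state m y t ω j; P]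

/-- The noise enters the last component of the state only: `B = (0, …, 0, 1)`. -/
def noiseVec (m : ℕ) : Fin m → ℝ := fun i => if (i : ℕ) + 1 = m then 1 else 0

/-- The coefficients of the operator of the backward equation.  The backward equation replaces the
drift matrix `F` of the forward equation by `F + B Bᵀ Π⁻¹`, so its operator is
`L_b y = L y - ∑ i, C_i y^(i)` with `C = Bᵀ Π⁻¹`. -/
def backwardCoeff {Ω : Type*} [MeasurableSpace Ω] {m : ℕ} (c : Fin m → ℝ → ℝ) (P : Measure Ω)
    (y : ℝ → Ω → ℝ) (i : Fin m) (t : ℝ) : ℝ :=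
  c i t - (noiseVec m ᵥ* (stateCov m P y t)⁻¹) i

/-! ### Fundamental solutions -/

/-- `h` solves `h^(m) + c_{m-1} h^(m-1) + ⋯ + c_0 h = 0` on `I`. -/
def IsHomogeneousSolution {m : ℕ} (I : Set ℝ) (c : Fin m → ℝ → ℝ) (h : ℝ → ℝ) : Prop :=
  ContDiffOn ℝ (m : WithTop ℕ∞) h I ∧
    ∀ t ∈ I, iteratedDeriv m h t + ∑ i : Fin m, c i t * iteratedDeriv i h t = 0

/-- A minimal set of fundamental solutions on `I`: `m` linearly independent solutions of the
homogeneous equation of order `m`. -/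
def IsFundamentalSystem {m : ℕ} (I : Set ℝ) (c : Fin m → ℝ → ℝ) (h : Fin m → ℝ → ℝ) : Prop :=
  (∀ i, IsHomogeneousSolution I c (h i)) ∧ LinearIndependent ℝ (fun i (t : I) => h i t)

/-! ### Kernel packets of product kernels -/

/-- The domain `∏ d, I d` of a product kernel. -/
def domainBox {D : ℕ} (I : Fin D → Set ℝ) : Set (Fin D → ℝ) := {x | ∀ d, x d ∈ I d}

/-- The product kernel `K(x, x') = ∏ d, K_d(x_d, x'_d)`. -/
def productKernel {D : ℕ} (K : Fin D → ℝ → ℝ → ℝ) (x x' : Fin D → ℝ) : ℝ :=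
  ∏ d, K d (x d) (x' d)

/-- The combination `∑ i, a_i K(·, t_i)`. -/
def packet {D n : ℕ} (K : Fin D → ℝ → ℝ → ℝ) (t : Fin n → Fin D → ℝ) (a : Fin n → ℝ)
    (x : Fin D → ℝ) : ℝ :=
  ∑ i, a i * productKernel K x (t i)

/-- The part in the domain of `U = ∏ d, ((-∞, min_i t_{i,d}) ∪ (max_i t_{i,d}, ∞))`. -/
def outerSet {D n : ℕ} (I : Fin D → Set ℝ) (t : Fin n → Fin D → ℝ) : Set (Fin D → ℝ) :=
  {x | x ∈ domainBox I ∧ ∀ d, (∀ i, x d < t i d) ∨ (∀ i, t i d < x d)}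

/-- `∑ i, a_i K(·, t_i)` vanishes on `U`. -/
def VanishesOutside {D n : ℕ} (I : Fin D → Set ℝ) (K : Fin D → ℝ → ℝ → ℝ)
    (t : Fin n → Fin D → ℝ) (a : Fin n → ℝ) : Prop :=
  ∀ x ∈ outerSet I t, packet K t a x = 0

/-- The entries of `H_d = [ψ_{d,1}, …, ψ_{d,m}, ζ_{d,1}, …, ζ_{d,m}]`. -/
def solutionVec {D m : ℕ} (ψ ζ : Fin D → Fin m → ℝ → ℝ) (d : Fin D) (k : Fin m ⊕ Fin m)
    (x : ℝ) : ℝ :=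
  Sum.elim (fun i => ψ d i x) (fun i => ζ d i x) k

/-- The `(2m)^D` entries of the tensor product `H = ⨂ d, H_d`, as a function on `ℝ^D`. -/
def tensorVec {D m : ℕ} (ψ ζ : Fin D → Fin m → ℝ → ℝ) (x : Fin D → ℝ)
    (k : Fin D → Fin m ⊕ Fin m) : ℝ :=
  ∏ d, solutionVec ψ ζ d (k d) (x d)

/-- `a` solves the system `∑ i, a_i H(t_i) = 0`. -/
def SolvesSystem {D n : ℕ} {κ : Type*} (H : (Fin D → ℝ) → κ → ℝ) (t : Fin n → Fin D → ℝ)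
    (a : Fin n → ℝ) : Prop :=
  ∑ i, a i • H (t i) = 0

end KernelPacket

end

noncomputable section

namespace KernelPacket

open Filter Topology Set

/-! ### Analytic preliminaries -/

/-! In `L²` the process becomes a curve `X` of state vectors, driven by increments `w s t` of
squared norm `t - s` that are orthogonal to the states up to time `s` (`IsStateCurve`). Covariances
are inner products, and the rest of the argument uses only this Hilbert space picture.

Testing the equation against a fixed vector gives a scalar differential equation. Against the state
at an earlier time `x` the noise drops out, so `K x t` solves the forward equation in `t` for `x <
t`. Against the state at a later time `x` the noise contributes the right derivative `Φ(x,t)B`, with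
`Φ` the forward transition matrix. Since `Cov(X(x), X(t)) = Φ(x,t)Π(t)`, this is the functional
`BᵀΠ(t)⁻¹` of the covariances with `X(t)`, which is the correction in the backward equation. Hence
`K x t` is a combination of the `ψ` on one side of `x` and of the `ζ` on the other, with
coefficients depending only on `x`.

All nondegeneracy comes from controllability (`IsFundamentalSystem.eq_zero_of_dotProduct`): a
combination of the state at `x` that is orthogonal to the noise in an interval before `x` is
trivial. It makes `Π` invertible and `K` strictly positive definite, makes the coefficients span on
every interval, and makes `ψ` and `ζ` jointly independent on every interval
(`IsStateCurve.eq_zero_of_sum_fundamental`). `IsPacketSystem` collects these facts for one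
coordinate.

The rest is linear algebra. On `U` a packet is the pairing of `∑ a_i H(t_i)` with a tensor product
of one-sided coefficient vectors; these separate, so it vanishes on `U` exactly when the system
holds (`vanishesOutside_iff`). There is one more unknown than equations, and positive definite Gram
matrices keep packets nonzero (`exists_packet_ne_zero`). For minimality, `H` separates on every
nonempty open subset of the box, so an open dense set of configurations has all maximal minors
nonzero (`IsLocallySeparating.subset_closure`), and there a solution with one zero coefficient is
zero. Fewer points or fewer equations would produce such a solution that is not zero. -/

lemma isOpen_timeInterval (t₀ T : EReal) : IsOpen (timeInterval t₀ T) :=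
  (isOpen_lt continuous_const continuous_coe_real_ereal).inter
    (isOpen_lt continuous_coe_real_ereal continuous_const)

lemma ordConnected_timeInterval (t₀ T : EReal) : (timeInterval t₀ T).OrdConnected :=
  ⟨fun _ hx _ hy _ hz => ⟨hx.1.trans_le (EReal.coe_le_coe_iff.2 hz.1),
    (EReal.coe_le_coe_iff.2 hz.2).trans_lt hy.2⟩⟩

lemma nonempty_timeInterval {t₀ T : EReal} (h : t₀ < T) : (timeInterval t₀ T).Nonempty := by
  obtain ⟨x, hx⟩ := EReal.lt_iff_exists_real_btwn.1 h
  exact ⟨x, hx⟩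

lemma hasDerivAt_iteratedDeriv {n : ℕ} {f : ℝ → ℝ} {I : Set ℝ} (hI : IsOpen I)
    (hf : ContDiffOn ℝ n f I) {i : ℕ} (hi : i < n) {t : ℝ} (ht : t ∈ I) :
    HasDerivAt (iteratedDeriv i f) (iteratedDeriv (i + 1) f t) t := by
  have h1 := hf.differentiableOn_iteratedDerivWithin (m := i) (by exact_mod_cast hi)
    hI.uniqueDiffOn
  have h2 : DifferentiableOn ℝ (iteratedDeriv i f) I :=
    h1.congr fun x hx => (iteratedDerivWithin_of_isOpen hI hx).symm
  rw [iteratedDeriv_succ]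
  exact ((h2 t ht).differentiableAt (hI.mem_nhds ht)).hasDerivAt

lemma continuousOn_iteratedDeriv {n : ℕ} {f : ℝ → ℝ} {I : Set ℝ} (hI : IsOpen I)
    (hf : ContDiffOn ℝ n f I) {i : ℕ} (hi : i ≤ n) : ContinuousOn (iteratedDeriv i f) I :=
  (hf.continuousOn_iteratedDerivWithin (m := i) (by exact_mod_cast hi) hI.uniqueDiffOn).congr
    fun _ hx => (iteratedDerivWithin_of_isOpen hI hx).symm

/-- Left Riemann sums of a continuous function over uniform partitions converge to the integral. -/
lemma tendsto_riemannSum {E : Type*} [NormedAddCommGroup E] [NormedSpace ℝ E] [CompleteSpace E]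
    {f : ℝ → E} {a b : ℝ} (hab : a ≤ b) (hf : ContinuousOn f (Icc a b)) :
    Tendsto (fun n : ℕ => ∑ k ∈ Finset.range (n + 1),
      ((b - a) / (n + 1)) • f (a + k * ((b - a) / (n + 1)))) atTop (𝓝 (∫ u in a..b, f u)) := by
  have huc := isCompact_Icc.uniformContinuousOn_of_continuous hf
  rw [Metric.uniformContinuousOn_iff] at huc
  rw [Metric.tendsto_atTop]
  intro ε hε
  -- The `+ 1` covers the case `a = b` and keeps the total error `ε' * (b - a)` strictly below `ε`.
  set ε' := ε / (2 * (b - a + 1)) with hε'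
  have hpos : 0 < b - a + 1 := by linarith
  obtain ⟨δ, hδ, H⟩ := huc ε' (by positivity)
  obtain ⟨N, hN⟩ := exists_nat_gt ((b - a) / δ)
  refine ⟨N, fun n hn => ?_⟩
  set h := (b - a) / ((n : ℝ) + 1) with hh
  have hn1 : (0 : ℝ) < (n : ℝ) + 1 := by positivity
  have h0 : 0 ≤ h := by have := sub_nonneg.2 hab; positivity
  have hmul : ((n : ℝ) + 1) * h = b - a := by rw [hh]; field_simp
  have hlt : h < δ := by
    rw [hh, div_lt_iff₀ hn1]
    rw [div_lt_iff₀ hδ] at hN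
    have : (N : ℝ) ≤ n := by exact_mod_cast hn
    nlinarith
  set p : ℕ → ℝ := fun k => a + k * h with hp
  have hp0 : p 0 = a := by simp [hp]
  have hpn : p (n + 1) = b := by simp only [hp]; push_cast; linarith
  have hstep : ∀ k, p (k + 1) = p k + h := fun k => by simp only [hp]; push_cast; ring
  have hmem : ∀ k ≤ n + 1, p k ∈ Icc a b := by
    intro k hk
    have : (k : ℝ) ≤ (n : ℝ) + 1 := by exact_mod_cast hk
    refine ⟨by simp only [hp]; have : (0 : ℝ) ≤ k * h := by positivity
               linarith, ?_⟩
    simp only [hp]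
    nlinarith
  have hsub : ∀ k < n + 1, Icc (p k) (p (k + 1)) ⊆ Icc a b := fun k hk =>
    Icc_subset_Icc (hmem k hk.le).1 (hmem (k + 1) hk).2
  have hle : ∀ k, p k ≤ p (k + 1) := fun k => by rw [hstep]; linarith
  have hint : ∀ k < n + 1, IntervalIntegrable f volume (p k) (p (k + 1)) := fun k hk =>
    ContinuousOn.intervalIntegrable (by rw [uIcc_of_le (hle k)]; exact hf.mono (hsub k hk))
  have hsum := intervalIntegral.sum_integral_adjacent_intervals hint
  rw [hp0, hpn] at hsum
  rw [dist_eq_norm, ← hsum, ← Finset.sum_sub_distrib]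
  have hterm : ∀ k ∈ Finset.range (n + 1),
      ‖h • f (a + k * h) - ∫ u in p k..p (k + 1), f u‖ ≤ ε' * h := by
    intro k hk
    have hk' := Finset.mem_range.1 hk
    have e1 : h • f (a + k * h) = ∫ _ in p k..p (k + 1), f (p k) := by
      rw [intervalIntegral.integral_const, hstep]; simp [hp]
    rw [e1, ← intervalIntegral.integral_sub intervalIntegrable_const (hint k hk')]
    have e2 : p (k + 1) - p k = h := by rw [hstep]; ring
    refine (intervalIntegral.norm_integral_le_of_norm_le_const (C := ε') fun x hx => ?_).trans
      (by rw [e2, abs_of_nonneg h0])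
    rw [uIoc_of_le (hle k)] at hx
    rw [← dist_eq_norm]
    refine (H _ (hmem k hk'.le) x (hsub k hk' ⟨hx.1.le, hx.2⟩) ?_).le
    rw [dist_comm, Real.dist_eq, abs_of_nonneg (by linarith [hx.1])]
    linarith [hx.2, hstep k]
  refine (norm_sum_le_of_le _ hterm).trans_lt ?_
  rw [Finset.sum_const, Finset.card_range, nsmul_eq_mul]
  push_cast
  have : ((n : ℝ) + 1) * (ε' * h) = ε' * (b - a) := by rw [← hmul]; ring
  rw [this, hε', div_mul_eq_mul_div, div_lt_iff₀ (by positivity)]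
  nlinarith [sub_nonneg.2 hab]

/-- For centred Gaussian variables, almost sure convergence to zero implies convergence in mean
square. -/
lemma tendsto_integral_sq_of_gaussian {Ω : Type*} [MeasurableSpace Ω] {P : Measure Ω}
    [IsProbabilityMeasure P] {Z : ℕ → Ω → ℝ} (hZ : ∀ n, HasGaussianLaw (Z n) P)
    (h0 : ∀ n, ∫ ω, Z n ω ∂P = 0) (hlim : ∀ᵐ ω ∂P, Tendsto (fun n => Z n ω) atTop (𝓝 0)) :
    Tendsto (fun n => ∫ ω, Z n ω ^ 2 ∂P) atTop (𝓝 0) := by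
  have hvar : ∀ n, Var[Z n; P] = ∫ ω, Z n ω ^ 2 ∂P := fun n =>
    variance_of_integral_eq_zero (hZ n).aemeasurable (h0 n)
  -- The characteristic function at `1` is `exp (-σ² / 2)`, so it determines the variance; its
  -- integrand is bounded, so dominated convergence applies without any moment bound.
  have hch : ∀ n, ∫ ω, Complex.exp (Z n ω * Complex.I) ∂P
      = Complex.exp (-(((∫ ω, Z n ω ^ 2 ∂P) / 2 : ℝ) : ℂ)) := by
    intro n
    have h1 : charFun (P.map (Z n)) 1 = ∫ ω, Complex.exp (Z n ω * Complex.I) ∂P := by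
      rw [charFun_apply_real, integral_map (hZ n).aemeasurable (by fun_prop)]
      simp
    rw [← h1, (hZ n).map_eq_gaussianReal, charFun_gaussianReal, h0, ← hvar,
      Real.coe_toNNReal _ (variance_nonneg _ _)]
    congr 1
    push_cast
    ring
  have hl : Tendsto (fun n => ∫ ω, Complex.exp (Z n ω * Complex.I) ∂P) atTop
      (𝓝 (∫ _, (1 : ℂ) ∂P)) := by
    refine tendsto_integral_of_dominated_convergence (fun _ => 1) (fun n => ?_)
      (integrable_const _) (fun n => ?_) ?_
    · have : AEMeasurable (fun ω => Complex.exp (Z n ω * Complex.I)) P := by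
        have := (hZ n).aemeasurable
        fun_prop
      exact this.aestronglyMeasurable
    · exact Eventually.of_forall fun ω => by rw [Complex.norm_exp_ofReal_mul_I]
    · filter_upwards [hlim] with ω hω
      have : Continuous fun x : ℝ => Complex.exp (x * Complex.I) := by fun_prop
      simpa [Function.comp_def] using (this.tendsto 0).comp hω
  simp only [hch, integral_const, probReal_univ, one_smul] at hl
  have hl2 : Tendsto (fun n => Real.exp (-((∫ ω, Z n ω ^ 2 ∂P) / 2))) atTop (𝓝 1) := by
    have := (continuous_norm.tendsto _).comp hl
    simpa [Function.comp_def, Complex.norm_exp] using this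
  have hl3 := (Real.continuousAt_log one_ne_zero).tendsto.comp hl2
  simp only [Function.comp_def, Real.log_exp, Real.log_one] at hl3
  convert hl3.const_mul (-2) using 1
  · funext n
    ring
  · simp

/-! ### The state as a curve in a Hilbert space -/

/-- The forward equation for a state `X` with values in a Hilbert space, driven by the noise
increments `w s t`, which are orthogonal to the past. -/
structure IsStateCurve {E : Type*} [NormedAddCommGroup E] [InnerProductSpace ℝ E] {m : ℕ}
    (I : Set ℝ) (c : Fin m → ℝ → ℝ) (X : ℝ → Fin m → E) (w : ℝ → ℝ → E) : Prop where
  continuousOn : ∀ i, ContinuousOn (fun t => X t i) I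
  hasDerivAt : ∀ t ∈ I, ∀ i j : Fin m, (i : ℕ) + 1 = j → HasDerivAt (fun t => X t i) (X t j) t
  equation : ∀ s ∈ I, ∀ t ∈ I, s ≤ t → ∀ l : Fin m, (l : ℕ) + 1 = m →
    X t l - X s l + ∫ u in s..t, ∑ i, c i u • X u i = w s t
  norm_noise : ∀ s ∈ I, ∀ t ∈ I, s ≤ t → inner ℝ (w s t) (w s t) = t - s
  orthogonal : ∀ r ∈ I, ∀ s ∈ I, ∀ t ∈ I, r ≤ s → s ≤ t → ∀ i, inner ℝ (X r i) (w s t) = 0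

section toL2

variable {Ω : Type*} [MeasurableSpace Ω] {P : Measure Ω}

open Classical in
/-- The class in `L²` of a square integrable function, and `0` for other functions. -/
def toL2 (P : Measure Ω) (f : Ω → ℝ) : Lp ℝ 2 P :=
  if h : MemLp f 2 P then h.toLp f else 0

lemma coeFn_toL2 {f : Ω → ℝ} (hf : MemLp f 2 P) : toL2 P f =ᵐ[P] f := by
  rw [toL2, dif_pos hf]
  exact hf.coeFn_toLp

lemma toL2_eq_iff {f : Ω → ℝ} (hf : MemLp f 2 P) {F : Lp ℝ 2 P} :
    F = toL2 P f ↔ F =ᵐ[P] f := by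
  rw [Lp.ext_iff]
  exact ⟨fun h => h.trans (coeFn_toL2 hf), fun h => h.trans (coeFn_toL2 hf).symm⟩

lemma inner_toL2 {f g : Ω → ℝ} (hf : MemLp f 2 P) (hg : MemLp g 2 P) :
    inner ℝ (toL2 P f) (toL2 P g) = ∫ ω, f ω * g ω ∂P := by
  rw [L2.inner_def]
  refine integral_congr_ae ?_
  filter_upwards [coeFn_toL2 hf, coeFn_toL2 hg] with ω h1 h2
  simp [h1, h2, mul_comm]

lemma sum_smul_toL2 {ι : Type*} (s : Finset ι) (a : ι → ℝ) {f : ι → Ω → ℝ}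
    (hf : ∀ i ∈ s, MemLp (f i) 2 P) :
    ∑ i ∈ s, a i • toL2 P (f i) = toL2 P (fun ω => ∑ i ∈ s, a i * f i ω) := by
  rw [toL2_eq_iff (memLp_finsetSum _ fun i hi => (hf i hi).const_mul _)]
  refine (Lp.coeFn_finsetSum _ _).trans ?_
  have h : ∀ᵐ ω ∂P, ∀ i ∈ s, (a i • toL2 P (f i) : Lp ℝ 2 P) ω = a i * f i ω := by
    refine (Finset.eventually_all s).2 fun i hi => ?_
    filter_upwards [Lp.coeFn_smul (a i) (toL2 P (f i)), coeFn_toL2 (hf i hi)] with ω h1 h2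
    rw [h1, Pi.smul_apply, h2, smul_eq_mul]
  filter_upwards [h] with ω hω
  rw [Finset.sum_apply]
  exact Finset.sum_congr rfl hω

/-- A subsequence of an `L²` convergent sequence converges almost everywhere. This identifies `L²`
limits with pathwise ones. -/
lemma ae_eq_of_tendsto_of_ae_tendsto {F : ℕ → Lp ℝ 2 P} {F' : Lp ℝ 2 P} {G : Ω → ℝ}
    (h : Tendsto F atTop (𝓝 F'))
    (hG : ∀ᵐ ω ∂P, Tendsto (fun n => F n ω) atTop (𝓝 (G ω))) : F' =ᵐ[P] G := by
  obtain ⟨ns, hns, hF⟩ := (tendstoInMeasure_of_tendsto_Lp h).exists_seq_tendsto_ae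
  filter_upwards [hF, hG] with ω h1 h2
  exact tendsto_nhds_unique h1 (h2.comp hns.tendsto_atTop)

end toL2

section Solution

variable {Ω : Type*} [MeasurableSpace Ω] {P : Measure Ω} {m : ℕ}
  {I : Set ℝ} {c : Fin m → ℝ → ℝ} {W y : ℝ → Ω → ℝ}

/-- The state in `L²`. -/
def stateL2 (m : ℕ) (P : Measure Ω) (y : ℝ → Ω → ℝ) (t : ℝ) (i : Fin m) : Lp ℝ 2 P :=
  toL2 P (fun ω => state m y t ω i)

lemma IsForwardSolution.hasGaussianLaw_state (hy : IsForwardSolution I c P W y) {t : ℝ}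
    (ht : t ∈ I) (i : Fin m) : HasGaussianLaw (fun ω => state m y t ω i) P :=
  hy.gaussian.hasGaussianLaw_eval (⟨t, ht⟩, i)

lemma IsForwardSolution.hasGaussianLaw_noise (hy : IsForwardSolution I c P W y) {s t : ℝ}
    (hs : s ∈ I) (ht : t ∈ I) (hst : s ≤ t) : HasGaussianLaw (fun ω => W t ω - W s ω) P :=
  (hy.wiener.law_increment s hs t ht hst).hasGaussianLaw

lemma IsForwardSolution.memLp_state (hy : IsForwardSolution I c P W y) {t : ℝ}
    (ht : t ∈ I) (i : Fin m) : MemLp (fun ω => state m y t ω i) 2 P :=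
  (hy.hasGaussianLaw_state ht i).memLp_two

variable [IsProbabilityMeasure P]

/-- Finite combinations of state components are centred Gaussian, so pathwise limits upgrade to mean
square limits. Continuity and differentiability of the curve in `L²` are both of this form. -/
lemma IsForwardSolution.tendsto_zero (hy : IsForwardSolution I c P W y) {r : ℕ}
    (a : ℕ → Fin r → ℝ) (u : ℕ → Fin r → ℝ) (hu : ∀ n j, u n j ∈ I) (i : Fin r → Fin m)
    (h : ∀ᵐ ω ∂P, Tendsto (fun n => ∑ j, a n j * state m y (u n j) ω (i j)) atTop (𝓝 0)) :
    Tendsto (fun n => ∑ j, a n j • stateL2 m P y (u n j) (i j)) atTop (𝓝 0) := by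
  have hG : ∀ n, HasGaussianLaw (fun ω => ∑ j, a n j * state m y (u n j) ω (i j)) P := fun n =>
    ((hy.gaussian.comp_right (fun j : Fin r => ((⟨u n j, hu n j⟩ : I), i j))).smul
      (a n)).hasGaussianLaw_fun_sum (I := Finset.univ)
  have key := tendsto_integral_sq_of_gaussian hG (fun n => ?_) h
  · rw [tendsto_zero_iff_norm_tendsto_zero]
    have hn : ∀ n, ‖∑ j, a n j • stateL2 m P y (u n j) (i j)‖
        = √(∫ ω, (∑ j, a n j * state m y (u n j) ω (i j)) ^ 2 ∂P) := fun n => by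
      simp only [stateL2]
      rw [sum_smul_toL2 _ _ (fun j _ => hy.memLp_state (hu n j) (i j)),
        norm_eq_sqrt_real_inner, inner_toL2 (hG n).memLp_two (hG n).memLp_two]
      simp only [sq]
    simp only [hn]
    have := (Real.continuous_sqrt.tendsto _).comp key
    rwa [Real.sqrt_zero] at this
  · rw [integral_finsetSum _ fun j _ =>
      ((hy.hasGaussianLaw_state (hu n j) (i j)).integrable).const_mul _]
    refine Finset.sum_eq_zero fun j _ => ?_
    rw [integral_const_mul, hy.centered _ (hu n j), mul_zero]

lemma IsForwardSolution.tendsto_zero_of_eventually (hy : IsForwardSolution I c P W y) {r : ℕ}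
    (a : ℕ → Fin r → ℝ) (u : ℕ → Fin r → ℝ) (hu : ∀ᶠ n in atTop, ∀ j, u n j ∈ I)
    (i : Fin r → Fin m)
    (h : ∀ᵐ ω ∂P, Tendsto (fun n => ∑ j, a n j * state m y (u n j) ω (i j)) atTop (𝓝 0)) :
    Tendsto (fun n => ∑ j, a n j • stateL2 m P y (u n j) (i j)) atTop (𝓝 0) := by
  obtain ⟨N, hN⟩ := eventually_atTop.1 hu
  rw [← tendsto_add_atTop_iff_nat N]
  refine hy.tendsto_zero (fun n => a (n + N)) (fun n => u (n + N))
    (fun n => hN _ (Nat.le_add_left _ _)) i ?_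
  filter_upwards [h] with ω hω
  exact (tendsto_add_atTop_iff_nat N).2 hω

lemma IsForwardSolution.continuousOn_stateL2 (hy : IsForwardSolution I c P W y) (hI : IsOpen I)
    (i : Fin m) : ContinuousOn (fun t => stateL2 m P y t i) I := by
  intro t ht
  refine ContinuousAt.continuousWithinAt ?_
  refine tendsto_of_seq_tendsto fun u hu => ?_
  have h := hy.tendsto_zero_of_eventually (fun _ => ![1, -1]) (fun n => ![u n, t]) ?_
    (fun _ => i) ?_
  · rw [tendsto_iff_norm_sub_tendsto_zero]
    simpa [Fin.sum_univ_two, sub_eq_add_neg] using h.norm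
  · filter_upwards [hu (hI.mem_nhds ht)] with n hn
    intro j
    fin_cases j
    · exact hn
    · exact ht
  · filter_upwards [hy.smooth_paths] with ω hω
    have hc := continuousOn_iteratedDeriv hI hω (i := i) (by omega)
    have := ((hc.continuousAt (hI.mem_nhds ht)).tendsto.comp hu).sub_const
      (iteratedDeriv i (fun u => y u ω) t)
    simpa [Fin.sum_univ_two, sub_eq_add_neg, state, Function.comp_def] using this

lemma IsForwardSolution.hasDerivAt_stateL2 (hy : IsForwardSolution I c P W y) (hI : IsOpen I)
    {i j : Fin m} (hij : (i : ℕ) + 1 = j) {t : ℝ} (ht : t ∈ I) :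
    HasDerivAt (fun t => stateL2 m P y t i) (stateL2 m P y t j) t := by
  rw [hasDerivAt_iff_tendsto_slope]
  refine tendsto_of_seq_tendsto fun u hu => ?_
  have hu' := tendsto_nhds_of_tendsto_nhdsWithin hu
  -- The three weights encode the difference quotient of component `i` minus component `j`.
  have h := hy.tendsto_zero_of_eventually (fun n => ![(u n - t)⁻¹, -(u n - t)⁻¹, -1])
    (fun n => ![u n, t, t]) ?_ ![i, i, j] ?_
  · rw [tendsto_iff_norm_sub_tendsto_zero]
    simpa [Fin.sum_univ_three, sub_eq_add_neg, slope_def_module, smul_add] using h.norm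
  · filter_upwards [hu' (hI.mem_nhds ht)] with n hn
    intro j
    fin_cases j
    · exact hn
    · exact ht
    · exact ht
  · filter_upwards [hy.smooth_paths] with ω hω
    have hd := hasDerivAt_iteratedDeriv hI hω (i := i) (by omega) ht
    rw [hasDerivAt_iff_tendsto_slope] at hd
    have := (hd.comp hu).sub_const (iteratedDeriv (i + 1) (fun u => y u ω) t)
    simpa [Fin.sum_univ_three, sub_eq_add_neg, slope_def_module, mul_add, state,
      Function.comp_def, hij] using this

/-- Both integrals are limits of the same Riemann sums, one in `L²` and one along each path, so no
joint measurability in time and `ω` is needed. -/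
lemma IsForwardSolution.integral_stateL2 (hy : IsForwardSolution I c P W y) (hI : IsOpen I)
    (hI' : I.OrdConnected) (hc : ∀ i, ContinuousOn (c i) I) {s t : ℝ} (hs : s ∈ I) (ht : t ∈ I)
    (hst : s ≤ t) :
    (∫ u in s..t, ∑ i, c i u • stateL2 m P y u i : Lp ℝ 2 P)
      =ᵐ[P] fun ω => ∫ u in s..t, ∑ i, c i u * state m y u ω i := by
  have hsub : Icc s t ⊆ I := hI'.out hs ht
  have hc1 : ContinuousOn (fun u => ∑ i, c i u • stateL2 m P y u i) (Icc s t) :=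
    continuousOn_finsetSum _ fun i _ =>
      ((hc i).smul (hy.continuousOn_stateL2 hI i)).mono hsub
  refine ae_eq_of_tendsto_of_ae_tendsto (tendsto_riemannSum hst hc1) ?_
  have hmem : ∀ n : ℕ, ∀ k ∈ Finset.range (n + 1), s + k * ((t - s) / (n + 1)) ∈ I := by
    intro n k hk
    have hk' : (k : ℝ) ≤ n + 1 := by
      exact_mod_cast (Finset.mem_range.1 hk).le
    have h0 : 0 ≤ t - s := sub_nonneg.2 hst
    have h1 : (k : ℝ) / (n + 1) ≤ 1 := by rw [div_le_one (by positivity)]; exact hk'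
    have h2 : 0 ≤ (k : ℝ) / (n + 1) := by positivity
    have h3 : (k : ℝ) * ((t - s) / (n + 1)) = k / (n + 1) * (t - s) := by ring
    rw [h3]
    exact hsub ⟨by nlinarith, by nlinarith⟩
  have hsum : ∀ᵐ ω ∂P, ∀ n : ℕ, (∑ k ∈ Finset.range (n + 1), ((t - s) / (n + 1)) •
      ∑ i, c i (s + k * ((t - s) / (n + 1))) • stateL2 m P y (s + k * ((t - s) / (n + 1))) i
        : Lp ℝ 2 P) ω = ∑ k ∈ Finset.range (n + 1), ((t - s) / (n + 1)) *
      ∑ i, c i (s + k * ((t - s) / (n + 1))) * state m y (s + k * ((t - s) / (n + 1))) ω i := by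
    refine ae_all_iff.2 fun n => ?_
    have hL : ∀ k ∈ Finset.range (n + 1), MemLp (fun ω => ∑ i,
        c i (s + k * ((t - s) / (n + 1))) * state m y (s + k * ((t - s) / (n + 1))) ω i) 2 P :=
      fun k hk => memLp_finsetSum _ fun i _ => (hy.memLp_state (hmem n k hk) i).const_mul _
    refine (toL2_eq_iff (memLp_finsetSum _ fun k hk => (hL k hk).const_mul _)).1 ?_
    rw [← sum_smul_toL2 _ _ hL]
    refine Finset.sum_congr rfl fun k hk => ?_
    congr 1
    exact sum_smul_toL2 _ _ fun i _ => hy.memLp_state (hmem n k hk) i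
  filter_upwards [hsum, hy.smooth_paths] with ω h1 h2
  simp only [h1]
  have hc2 : ContinuousOn (fun u => ∑ i, c i u * state m y u ω i) (Icc s t) :=
    continuousOn_finsetSum _ fun i _ =>
      ((hc i).mul (continuousOn_iteratedDeriv hI h2 (i := i) (by omega))).mono hsub
  exact tendsto_riemannSum hst hc2

/-- A solution of the forward stochastic differential equation defines a state curve in `L²`. -/
theorem IsForwardSolution.isStateCurve (hy : IsForwardSolution I c P W y) (hI : IsOpen I)
    (hI' : I.OrdConnected) (hc : ∀ i, ContinuousOn (c i) I) :
    IsStateCurve I c (stateL2 m P y) (fun s t => toL2 P (fun ω => W t ω - W s ω)) where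
  continuousOn := hy.continuousOn_stateL2 hI
  hasDerivAt t ht i j hij := hy.hasDerivAt_stateL2 hI hij ht
  equation s hs t ht hst l hl := by
    rw [toL2_eq_iff (hy.hasGaussianLaw_noise hs ht hst).memLp_two]
    have hl' : (l : ℕ) = m - 1 := by omega
    filter_upwards [Lp.coeFn_add (stateL2 m P y t l - stateL2 m P y s l)
        (∫ u in s..t, ∑ i, c i u • stateL2 m P y u i),
      Lp.coeFn_sub (stateL2 m P y t l) (stateL2 m P y s l),
      hy.integral_stateL2 hI hI' hc hs ht hst, coeFn_toL2 (hy.memLp_state ht l),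
      coeFn_toL2 (hy.memLp_state hs l), hy.equation s hs t ht hst] with ω h1 h2 h3 h4 h5 h6
    rw [h1, Pi.add_apply, h2, Pi.sub_apply, h3, ← h6, stateL2, stateL2, h4, h5, state, state, hl']
  norm_noise s hs t ht hst := by
    have hG := hy.hasGaussianLaw_noise hs ht hst
    have hlaw := hy.wiener.law_increment s hs t ht hst
    rw [inner_toL2 hG.memLp_two hG.memLp_two]
    have h0 : ∫ ω, (W t ω - W s ω) ∂P = 0 := by
      rw [hlaw.integral_eq, integral_id_gaussianReal]
    have hv : Var[fun ω => W t ω - W s ω; P] = t - s := by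
      rw [hlaw.variance_eq, variance_id_gaussianReal, Real.coe_toNNReal _ (sub_nonneg.2 hst)]
    rw [variance_of_integral_eq_zero hG.aemeasurable h0] at hv
    simpa only [sq] using hv
  orthogonal r hr s hs t ht hrs hst i := by
    have hG := hy.hasGaussianLaw_noise hs ht hst
    rw [stateL2, inner_toL2 (hy.memLp_state hr i) hG.memLp_two]
    have hev : Measurable fun v : Fin m → ℝ => v i := measurable_pi_apply i
    have hmeas : Measurable fun p : {t : ℝ // t ∈ I ∧ r ≤ t} → ℝ =>
        p ⟨t, ht, hrs.trans hst⟩ - p ⟨s, hs, hrs⟩ := by fun_prop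
    have hind := (hy.nonanticipating r hr).comp hev hmeas
    have hind' : IndepFun (fun ω => state m y r ω i) (fun ω => W t ω - W s ω) P := by
      convert hind using 1
      all_goals
        funext ω
        simp
    rw [hind'.integral_fun_mul_eq_mul_integral
      (hy.hasGaussianLaw_state hr i).aemeasurable.aestronglyMeasurable
      hG.aemeasurable.aestronglyMeasurable, hy.centered r hr i, zero_mul]

lemma IsForwardSolution.stateCov_eq_inner (hy : IsForwardSolution I c P W y) {t : ℝ} (ht : t ∈ I)
    (i j : Fin m) :
    stateCov m P y t i j = inner ℝ (stateL2 m P y t i) (stateL2 m P y t j) := by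
  rw [stateCov, Matrix.of_apply, covariance_eq_sub (hy.memLp_state ht i) (hy.memLp_state ht j),
    hy.centered t ht i, zero_mul, sub_zero, stateL2, stateL2,
    inner_toL2 (hy.memLp_state ht i) (hy.memLp_state ht j)]
  rfl

lemma IsForwardSolution.kernel_eq_inner (hy : IsForwardSolution I c P W y) (i : Fin m)
    (hi : (i : ℕ) = 0) {s t : ℝ} (hs : s ∈ I) (ht : t ∈ I) :
    kernel P y s t = inner ℝ (stateL2 m P y s i) (stateL2 m P y t i) := by
  have hst : ∀ u, y u = fun ω => state m y u ω i := fun u => by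
    funext ω
    simp [state, hi]
  rw [kernel, hst s, hst t, covariance_eq_sub (hy.memLp_state hs i) (hy.memLp_state ht i),
    hy.centered t ht i, mul_zero, sub_zero, stateL2, stateL2,
    inner_toL2 (hy.memLp_state hs i) (hy.memLp_state ht i)]
  rfl

end Solution

/-! ### Linear differential equations and Wronskian matrices -/

lemma noiseVec_eq_single {m : ℕ} {l : Fin m} (hl : (l : ℕ) + 1 = m) :
    noiseVec m = Pi.single l 1 := by
  funext i
  by_cases hi : i = l
  · subst hi
    simp [noiseVec, hl]
  · have : ¬ (i : ℕ) + 1 = m := fun h => hi (Fin.ext (by omega))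
    simp [noiseVec, hi, this]

section ODE

variable {m : ℕ} {I : Set ℝ} {c : Fin m → ℝ → ℝ}

/-- The vector field of the first order system of `h^(m) + c_{m-1} h^(m-1) + ⋯ + c_0 h = 0`. -/
def companion (c : Fin m → ℝ → ℝ) (t : ℝ) (z : Fin m → ℝ) (i : Fin m) : ℝ :=
  if h : (i : ℕ) + 1 < m then z ⟨i + 1, h⟩ else -∑ j, c j t * z j

lemma companion_of_succ {t : ℝ} {z : Fin m → ℝ} {i j : Fin m} (h : (i : ℕ) + 1 = j) :
    companion c t z i = z j := by
  have h' : (i : ℕ) + 1 < m := h ▸ j.2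
  rw [companion, dif_pos h']
  congr 1
  exact Fin.ext h

lemma companion_last {t : ℝ} {z : Fin m → ℝ} {l : Fin m} (h : (l : ℕ) + 1 = m) :
    companion c t z l = -∑ j, c j t * z j := by
  rw [companion, dif_neg (by omega)]

lemma companion_sub (t : ℝ) (x z : Fin m → ℝ) :
    companion c t (x - z) = companion c t x - companion c t z := by
  funext i
  by_cases h : (i : ℕ) + 1 < m
  · simp [companion, h]
  · simp only [companion, dif_neg h, Pi.sub_apply, mul_sub, Finset.sum_sub_distrib]
    ring

lemma exists_lipschitz_companion {a b : ℝ} (hc : ∀ i, ContinuousOn (c i) (Icc a b)) :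
    ∃ K, ∀ t ∈ Icc a b, LipschitzOnWith K (companion c t) univ := by
  choose C hC using fun i => isCompact_Icc.exists_bound_of_continuousOn (hc i)
  refine ⟨Real.toNNReal (1 + ∑ i, |C i|), fun t ht => ?_⟩
  have hpos : 0 ≤ ∑ i, |C i| := Finset.sum_nonneg fun i _ => abs_nonneg _
  refine (LipschitzWith.of_dist_le_mul fun x z => ?_).lipschitzOnWith
  rw [Real.coe_toNNReal _ (by positivity), dist_eq_norm, dist_eq_norm, ← companion_sub]
  refine (pi_norm_le_iff_of_nonneg (by positivity)).2 fun i => ?_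
  by_cases h : (i : ℕ) + 1 < m
  · rw [companion, dif_pos h]
    refine (norm_le_pi_norm _ _).trans (le_mul_of_one_le_left (norm_nonneg _) (by linarith))
  · rw [companion, dif_neg h, norm_neg]
    refine (norm_sum_le_of_le (f := fun j => c j t * (x - z) j) (n := fun j => |C j| * ‖x - z‖)
      _ fun j _ => ?_).trans ?_
    · rw [norm_mul]
      gcongr
      · exact (hC j t ht).trans (le_abs_self _)
      · exact norm_le_pi_norm _ _
    · rw [← Finset.sum_mul]
      gcongr
      linarith

/-- A solution on `[a, b]` of the first order system, with derivatives from the right. -/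
def IsRightSolution (c : Fin m → ℝ → ℝ) (a b : ℝ) (f : ℝ → Fin m → ℝ) : Prop :=
  ContinuousOn f (Icc a b) ∧
    ∀ t ∈ Ico a b, HasDerivWithinAt f (companion c t (f t)) (Ici t) t

/-- Right derivatives suffice for uniqueness. Correlations with the state are differentiated only to
the right, where the new noise is orthogonal to the past. -/
lemma IsRightSolution.eqOn {a b : ℝ} {f g : ℝ → Fin m → ℝ}
    (hc : ∀ i, ContinuousOn (c i) (Icc a b)) (hf : IsRightSolution c a b f)
    (hg : IsRightSolution c a b g) (h : f a = g a) : EqOn f g (Icc a b) := by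
  obtain ⟨K, hK⟩ := exists_lipschitz_companion hc
  exact ODE_solution_unique_of_mem_Icc_right (v := companion c) (s := fun _ => univ)
    (fun t ht => hK t ⟨ht.1, ht.2.le⟩) hf.1 hf.2 (fun _ _ => mem_univ _) hg.1 hg.2
    (fun _ _ => mem_univ _) h

/-- The matrix of the derivatives of order less than `m` of a system of functions. -/
def wronskian (h : Fin m → ℝ → ℝ) (t : ℝ) : Matrix (Fin m) (Fin m) ℝ :=
  Matrix.of fun i k => iteratedDeriv i (h k) t

lemma wronskian_mulVec (h : Fin m → ℝ → ℝ) (t : ℝ) (β : Fin m → ℝ) (i : Fin m) :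
    (wronskian h t *ᵥ β) i = ∑ k, iteratedDeriv i (h k) t * β k := rfl

variable {h : Fin m → ℝ → ℝ}

lemma IsFundamentalSystem.hasDerivAt (hI : IsOpen I) (hh : IsFundamentalSystem I c h)
    (β : Fin m → ℝ) {t : ℝ} (ht : t ∈ I) :
    HasDerivAt (fun t => wronskian h t *ᵥ β) (companion c t (wronskian h t *ᵥ β)) t := by
  refine hasDerivAt_pi.2 fun i => ?_
  have hd : HasDerivAt (fun t => (wronskian h t *ᵥ β) i)
      (∑ k, iteratedDeriv (i + 1) (h k) t * β k) t := by
    simp only [wronskian_mulVec]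
    exact HasDerivAt.fun_sum fun k _ =>
      (hasDerivAt_iteratedDeriv hI (hh.1 k).1 i.2 ht).mul_const _
  suffices e : companion c t (wronskian h t *ᵥ β) i
      = ∑ k, iteratedDeriv (i + 1) (h k) t * β k by rwa [← e] at hd
  by_cases hi : (i : ℕ) + 1 < m
  · rw [companion, dif_pos hi]
    rfl
  · have him : (i : ℕ) + 1 = m := by omega
    rw [companion, dif_neg hi, him]
    simp only [wronskian_mulVec, Finset.mul_sum]
    rw [Finset.sum_comm, ← Finset.sum_neg_distrib]
    refine Finset.sum_congr rfl fun k _ => ?_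
    rw [eq_neg_of_add_eq_zero_left ((hh.1 k).2 t ht), neg_mul, Finset.sum_mul]
    simp only [mul_assoc]

lemma IsFundamentalSystem.continuousOn_wronskian (hI : IsOpen I)
    (hh : IsFundamentalSystem I c h) : ContinuousOn (wronskian h) I := by
  refine continuousOn_pi.2 fun i => continuousOn_pi.2 fun k => ?_
  exact continuousOn_iteratedDeriv hI (hh.1 k).1 i.2.le

lemma IsFundamentalSystem.isRightSolution (hI : IsOpen I) (hh : IsFundamentalSystem I c h)
    (β : Fin m → ℝ) {a b : ℝ} (hab : Icc a b ⊆ I) :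
    IsRightSolution c a b (fun t => wronskian h t *ᵥ β) :=
  ⟨fun _ ht => (hh.hasDerivAt hI β (hab ht)).continuousAt.continuousWithinAt,
    fun _ ht => (hh.hasDerivAt hI β (hab ⟨ht.1, ht.2.le⟩)).hasDerivWithinAt⟩

/-- A null vector of the Wronskian at one time gives a combination with zero data there; uniqueness
in both time directions makes it vanish on `I`, against linear independence. -/
lemma IsFundamentalSystem.isUnit_det (hI : IsOpen I) (hI' : I.OrdConnected)
    (hc : ∀ i, ContinuousOn (c i) I) (hh : IsFundamentalSystem I c h) {t : ℝ} (ht : t ∈ I) :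
    IsUnit (wronskian h t).det := by
  rw [isUnit_iff_ne_zero]
  intro h0
  obtain ⟨β, hβ, h1⟩ := Matrix.exists_mulVec_eq_zero_iff.2 h0
  have hz : ∀ s ∈ I, wronskian h s *ᵥ β = 0 := by
    intro s hs
    rcases le_total t s with hts | hts
    · have hsub : Icc t s ⊆ I := hI'.out ht hs
      have := (hh.isRightSolution hI β hsub).eqOn (fun i => (hc i).mono hsub)
        (hh.isRightSolution hI 0 hsub) (by simp [h1]) ⟨hts, le_rfl⟩
      simpa using this
    · have hsub : Icc s t ⊆ I := hI'.out hs ht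
      obtain ⟨K, hK⟩ := exists_lipschitz_companion fun i => (hc i).mono hsub
      have hd := fun β => hh.isRightSolution hI β hsub
      have := ODE_solution_unique_of_mem_Icc_left (v := companion c) (s := fun _ => univ)
        (f := fun t => wronskian h t *ᵥ β) (g := fun t => wronskian h t *ᵥ 0)
        (fun t ht => hK t ⟨ht.1.le, ht.2⟩) (hd β).1
        (fun u hu => (hh.hasDerivAt hI β (hsub ⟨hu.1.le, hu.2⟩)).hasDerivWithinAt)
        (fun _ _ => mem_univ _) (hd 0).1
        (fun u hu => (hh.hasDerivAt hI 0 (hsub ⟨hu.1.le, hu.2⟩)).hasDerivWithinAt)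
        (fun _ _ => mem_univ _) (by simp [h1]) ⟨le_rfl, hts⟩
      simpa using this
  refine hβ (funext fun k => ?_)
  refine Fintype.linearIndependent_iff.1 hh.2 β (funext fun s => ?_) k
  have := congrFun (hz s s.2) ⟨0, k.pos⟩
  rw [wronskian_mulVec] at this
  simpa [mul_comm] using this

/-- The values of a solution at two times are related by the transition matrix. -/
lemma IsFundamentalSystem.propagation (hI : IsOpen I) (hI' : I.OrdConnected)
    (hc : ∀ i, ContinuousOn (c i) I) (hh : IsFundamentalSystem I c h) {a b : ℝ}
    (hab : Icc a b ⊆ I) {f : ℝ → Fin m → ℝ} (hf : IsRightSolution c a b f) {s t : ℝ}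
    (hs : s ∈ Icc a b) (ht : t ∈ Icc a b) :
    (wronskian h t)⁻¹ *ᵥ f t = (wronskian h s)⁻¹ *ᵥ f s := by
  have ha : a ∈ Icc a b := ⟨le_rfl, hs.1.trans hs.2⟩
  have hu := fun u (hu : u ∈ Icc a b) => hh.isUnit_det hI hI' hc (hab hu)
  have key : ∀ u ∈ Icc a b, (wronskian h u)⁻¹ *ᵥ f u = (wronskian h a)⁻¹ *ᵥ f a := by
    intro u hu'
    have := hf.eqOn (fun i => (hc i).mono hab)
      (hh.isRightSolution hI ((wronskian h a)⁻¹ *ᵥ f a) hab)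
      (by simp only [mulVec_mulVec, mul_nonsing_inv _ (hu a ha), one_mulVec]) hu'
    rw [this]
    simp only [mulVec_mulVec, ← Matrix.mul_assoc, nonsing_inv_mul _ (hu u hu'), Matrix.one_mul]
  rw [key t ht, key s hs]

lemma continuousOn_inv_of_isUnit_det {M : ℝ → Matrix (Fin m) (Fin m) ℝ}
    (hM : ContinuousOn M I) (hu : ∀ t ∈ I, IsUnit (M t).det) :
    ContinuousOn (fun t => (M t)⁻¹) I := by
  have h1 : ContinuousOn (fun t => (M t).det) I :=
    (continuous_id.matrix_det).comp_continuousOn hM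
  have h2 : ContinuousOn (fun t => (M t).adjugate) I :=
    (continuous_id.matrix_adjugate).comp_continuousOn hM
  have h3 : ContinuousOn (fun t => ((M t).det)⁻¹ • (M t).adjugate) I :=
    (h1.inv₀ fun t ht => (hu t ht).ne_zero).smul h2
  refine h3.congr fun t _ => ?_
  rw [Matrix.inv_def, Ring.inverse_eq_inv']

/-- Controllability of the pair (companion matrix, noise vector). -/
lemma IsFundamentalSystem.eq_zero_of_dotProduct (hI : IsOpen I) (hI' : I.OrdConnected)
    (hc : ∀ i, ContinuousOn (c i) I) (hh : IsFundamentalSystem I c h) {a b : ℝ} (hab : a < b)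
    (hJ : Ioo a b ⊆ I) {κ : Fin m → ℝ}
    (hκ : ∀ s ∈ Ioo a b, κ ⬝ᵥ ((wronskian h s)⁻¹ *ᵥ noiseVec m) = 0) : κ = 0 := by
  have hu := fun u (hu : u ∈ Ioo a b) => hh.isUnit_det hI hI' hc (hJ hu)
  -- `p` is the adjoint solution, and its components are shown to vanish from the last one down. It
  -- is never differentiated: continuity and the constancy of its pairing with solutions (`hpair`)
  -- are enough.
  set p : ℝ → Fin m → ℝ := fun s => κ ᵥ* (wronskian h s)⁻¹ with hp
  have hpc : ∀ i, ContinuousOn (fun s => p s i) (Ioo a b) := by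
    intro i
    have h1 := continuousOn_inv_of_isUnit_det ((hh.continuousOn_wronskian hI).mono hJ) hu
    have h2 : ContinuousOn (fun s => ∑ j, κ j * (wronskian h s)⁻¹ j i) (Ioo a b) :=
      continuousOn_finsetSum _ fun j _ =>
        continuousOn_const.mul (continuousOn_pi.1 (continuousOn_pi.1 h1 j) i)
    exact h2
  have hlast : ∀ l : Fin m, (l : ℕ) + 1 = m → ∀ s ∈ Ioo a b, p s l = 0 := by
    intro l hl s hs
    have h1 := hκ s hs
    rw [dotProduct_mulVec, noiseVec_eq_single hl, dotProduct_single_one] at h1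
    exact h1
  have hpair : ∀ s ∈ Ioo a b, ∀ β, p s ⬝ᵥ (wronskian h s *ᵥ β) = κ ⬝ᵥ β := by
    intro s hs β
    rw [hp, ← dotProduct_mulVec, mulVec_mulVec, nonsing_inv_mul _ (hu s hs), one_mulVec]
  have hall : ∀ k : ℕ, ∀ i : Fin m, (i : ℕ) + 1 + k = m → ∀ s ∈ Ioo a b, p s i = 0 := by
    intro k
    induction k with
    | zero => exact fun i hi => hlast i (by omega)
    | succ k ih =>
      intro i hi s hs
      have hlt : (i : ℕ) + 1 < m := by omega
      set j : Fin m := ⟨i + 1, hlt⟩ with hj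
      have hpj := ih j (by simp only [hj]; omega)
      -- The solution with coordinates `β` passes through the basis vector `j` at time `s`. Its
      -- derivative there has entry `1` at `i` and otherwise only a last entry, where `p` vanishes;
      -- pairing the slope with `p` therefore isolates `p s i`.
      set β := (wronskian h s)⁻¹ *ᵥ Pi.single j 1 with hβ
      have hφ : wronskian h s *ᵥ β = Pi.single j 1 := by
        rw [hβ, mulVec_mulVec, mul_nonsing_inv _ (hu s hs), one_mulVec]
      have hκβ : κ ⬝ᵥ β = 0 := by
        rw [← hpair s hs β, hφ, dotProduct_single_one]
        exact hpj s hs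
      have hd := hh.hasDerivAt hI β (hJ hs)
      rw [hφ] at hd
      have hsl : ∀ q, Tendsto (slope (fun t => (wronskian h t *ᵥ β) q) s) (𝓝[≠] s)
          (𝓝 (companion c s (Pi.single j 1) q)) := fun q =>
        hasDerivAt_iff_tendsto_slope.1 (hasDerivAt_pi.1 hd q)
      have hpt : ∀ q, Tendsto (fun t => p t q) (𝓝[≠] s) (𝓝 (p s q)) := fun q =>
        ((hpc q).continuousAt (isOpen_Ioo.mem_nhds hs)).tendsto.mono_left nhdsWithin_le_nhds
      have hlim := tendsto_finsetSum Finset.univ fun q _ => (hpt q).mul (hsl q)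
      have hzero : ∀ᶠ t in 𝓝[≠] s,
          ∑ q, p t q * slope (fun t => (wronskian h t *ᵥ β) q) s t = 0 := by
        filter_upwards [nhdsWithin_le_nhds (isOpen_Ioo.mem_nhds hs)] with t ht
        have h1 := hpair t ht β
        rw [hκβ] at h1
        have h2 : p t ⬝ᵥ (Pi.single j 1) = 0 := by
          rw [dotProduct_single_one]
          exact hpj t ht
        have h3 : p t ⬝ᵥ (wronskian h t *ᵥ β - (Pi.single j 1 : Fin m → ℝ)) = 0 := by
          rw [dotProduct_sub, h1, h2, sub_zero]
        have h4 : ∀ q, p t q * slope (fun t => (wronskian h t *ᵥ β) q) s t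
            = (t - s)⁻¹ * (p t q * (wronskian h t *ᵥ β - (Pi.single j 1 : Fin m → ℝ)) q) := by
          intro q
          rw [slope_def_module, smul_eq_mul, hφ, Pi.sub_apply]
          ring
        simp only [h4]
        rw [← Finset.mul_sum]
        rw [dotProduct] at h3
        rw [h3, mul_zero]
      have hlim0 := tendsto_nhds_unique
        (hlim.congr' hzero) tendsto_const_nhds
      rw [Finset.sum_eq_single i] at hlim0
      · rw [companion_of_succ (j := j) rfl, Pi.single_eq_same, mul_one] at hlim0
        exact hlim0
      · intro q _ hq
        by_cases hqm : (q : ℕ) + 1 < m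
        · rw [companion_of_succ (j := ⟨q + 1, hqm⟩) rfl, Pi.single_eq_of_ne, mul_zero]
          intro h
          refine hq (Fin.ext ?_)
          have := congrArg Fin.val h
          simp only [hj] at this
          omega
        · rw [hlast q (by omega) s hs, zero_mul]
      · simp
  obtain ⟨s, hs⟩ := nonempty_Ioo.2 hab
  have hps : p s = 0 := funext fun i => hall (m - 1 - i) i (by omega) s hs
  have : κ = p s ᵥ* wronskian h s := by
    rw [hp, vecMul_vecMul, nonsing_inv_mul _ (hu s hs), vecMul_one]
  rw [this, hps, zero_vecMul]

end ODE

/-! ### Correlation structure of a state curve -/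

lemma hasDerivAt_integral_of_continuousOn {E : Type*} [NormedAddCommGroup E] [NormedSpace ℝ E]
    [CompleteSpace E] {I : Set ℝ} (hI : IsOpen I) {g : ℝ → E} (hg : ContinuousOn g I) {t : ℝ}
    (ht : t ∈ I) : HasDerivAt (fun u => ∫ x in t..u, g x) (g t) t :=
  intervalIntegral.integral_hasDerivAt_right (by simp)
    (hg.stronglyMeasurableAtFilter hI t ht) (hg.continuousAt (hI.mem_nhds ht))

section StateCurve

variable {E : Type*} [NormedAddCommGroup E] [InnerProductSpace ℝ E]
  {m : ℕ} {I : Set ℝ} {c : Fin m → ℝ → ℝ} {X : ℝ → Fin m → E} {w : ℝ → ℝ → E}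

/-- The cross-covariance matrix of the states at two times. -/
def crossCov (X : ℝ → Fin m → E) (s t : ℝ) : Matrix (Fin m) (Fin m) ℝ :=
  Matrix.of fun i j => inner ℝ (X s i) (X t j)

lemma transpose_crossCov (s t : ℝ) : (crossCov X s t)ᵀ = crossCov X t s := by
  ext i j
  exact real_inner_comm _ _

lemma IsStateCurve.noise_self (hX : IsStateCurve I c X w) {t : ℝ} (ht : t ∈ I) : w t t = 0 := by
  have := hX.norm_noise t ht t ht le_rfl
  rwa [sub_self, inner_self_eq_zero] at this

lemma IsStateCurve.continuousOn_drift (hX : IsStateCurve I c X w)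
    (hc : ∀ i, ContinuousOn (c i) I) : ContinuousOn (fun u => ∑ i, c i u • X u i) I :=
  continuousOn_finsetSum _ fun i _ => (hc i).smul (hX.continuousOn i)

lemma IsStateCurve.inner_equation [CompleteSpace E]
    (hX : IsStateCurve I c X w) (hI' : I.OrdConnected)
    (hc : ∀ i, ContinuousOn (c i) I) (v : E) {s t : ℝ} (hs : s ∈ I) (ht : t ∈ I) (hst : s ≤ t)
    {l : Fin m} (hl : (l : ℕ) + 1 = m) :
    inner ℝ v (X t l) = inner ℝ v (X s l) - (∫ u in s..t, ∑ i, c i u * inner ℝ v (X u i))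
      + inner ℝ v (w s t) := by
  have hint : IntervalIntegrable (fun u => ∑ i, c i u • X u i) volume s t :=
    ContinuousOn.intervalIntegrable
      (by rw [uIcc_of_le hst]; exact (hX.continuousOn_drift hc).mono (hI'.out hs ht))
  have h1 := (innerSL ℝ v).intervalIntegral_comp_comm hint
  simp only [innerSL_apply_apply, inner_sum, inner_smul_right] at h1
  rw [← hX.equation s hs t ht hst l hl, inner_add_right, inner_sub_right, ← h1]
  ring

/-- `u` is orthogonal to the noise after time `s`. -/
def IsPast (I : Set ℝ) (w : ℝ → ℝ → E) (s : ℝ) (u : E) : Prop :=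
  ∀ t ∈ I, ∀ t' ∈ I, s ≤ t → t ≤ t' → inner ℝ u (w t t') = 0

lemma IsStateCurve.isPast_state (hX : IsStateCurve I c X w) {r s : ℝ} (hr : r ∈ I) (hrs : r ≤ s)
    (i : Fin m) : IsPast I w s (X r i) :=
  fun t ht t' ht' hst htt' => hX.orthogonal r hr t ht t' ht' (hrs.trans hst) htt' i

/-- By the equation the increment is built from states at times in `[r, s]`, all orthogonal to later
noise. -/
lemma IsStateCurve.isPast_noise [CompleteSpace E]
    (hX : IsStateCurve I c X w) (hI' : I.OrdConnected)
    (hc : ∀ i, ContinuousOn (c i) I) (hm : 1 ≤ m) {r s : ℝ} (hr : r ∈ I) (hs : s ∈ I)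
    (hrs : r ≤ s) : IsPast I w s (w r s) := by
  intro t ht t' ht' hst htt'
  have h := hX.inner_equation hI' hc (w t t') hr hs hrs (l := ⟨m - 1, by omega⟩)
    (Nat.sub_add_cancel hm)
  have h0 : ∀ u ∈ Icc r s, ∀ i, inner ℝ (w t t') (X u i) = 0 := fun u hu i => by
    rw [real_inner_comm]
    exact hX.orthogonal u (hI'.out hr hs hu) t ht t' ht' (hu.2.trans hst) htt' i
  have h1 : ∫ u in r..s, ∑ i, c i u * inner ℝ (w t t') (X u i) = 0 := by
    rw [intervalIntegral.integral_congr (g := fun _ => (0 : ℝ)) fun u hu => ?_]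
    · simp
    · rw [uIcc_of_le hrs] at hu
      simp [h0 u hu]
  rw [h0 s ⟨hrs, le_rfl⟩, h0 r ⟨le_rfl, hrs⟩, h1] at h
  rw [real_inner_comm]
  linarith

/-- The right derivative of the last component of the state, tested against a vector. -/
lemma IsStateCurve.hasDerivWithinAt_inner_last [CompleteSpace E]
    (hX : IsStateCurve I c X w) (hI : IsOpen I)
    (hI' : I.OrdConnected) (hc : ∀ i, ContinuousOn (c i) I) {v : E} {t q : ℝ} (ht : t ∈ I)
    (hq : HasDerivWithinAt (fun t' => inner ℝ v (w t t')) q (Ici t) t)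
    {l : Fin m} (hl : (l : ℕ) + 1 = m) :
    HasDerivWithinAt (fun t' => inner ℝ v (X t' l)) (q - ∑ i, c i t * inner ℝ v (X t i))
      (Ici t) t := by
  have hcont : ContinuousOn (fun u => ∑ i, c i u * inner ℝ v (X u i)) I :=
    continuousOn_finsetSum _ fun i _ => (hc i).mul (continuousOn_const.inner (hX.continuousOn i))
  have h1 := (hasDerivAt_integral_of_continuousOn hI hcont ht).hasDerivWithinAt (s := Ici t)
  have h2 := (h1.const_sub (inner ℝ v (X t l))).add hq
  rw [neg_add_eq_sub] at h2
  refine h2.congr_of_eventuallyEq ?_ ?_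
  · filter_upwards [self_mem_nhdsWithin, nhdsWithin_le_nhds (hI.mem_nhds ht)] with t' h3 h4
    exact hX.inner_equation hI' hc v ht h4 h3 hl
  · exact hX.inner_equation hI' hc v ht ht le_rfl hl

/-- Common source of both equations: the noise rate `q` is absorbed into modified coefficients `c'`.
A past vector has `q = 0` and keeps `c`; a later state leads to the backward coefficients. -/
lemma IsStateCurve.hasDerivWithinAt_inner [CompleteSpace E]
    (hX : IsStateCurve I c X w) (hI : IsOpen I)
    (hI' : I.OrdConnected) (hc : ∀ i, ContinuousOn (c i) I) {v : E} {t q : ℝ} (ht : t ∈ I)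
    (hq : HasDerivWithinAt (fun t' => inner ℝ v (w t t')) q (Ici t) t)
    (c' : Fin m → ℝ → ℝ) (hc' : ∑ i, c' i t * inner ℝ v (X t i)
      = ∑ i, c i t * inner ℝ v (X t i) - q) :
    HasDerivWithinAt (fun t' i => inner ℝ v (X t' i))
      (companion c' t (fun i => inner ℝ v (X t i))) (Ici t) t := by
  refine hasDerivWithinAt_pi.2 fun i => ?_
  by_cases hi : (i : ℕ) + 1 < m
  · rw [companion_of_succ (j := ⟨i + 1, hi⟩) rfl]
    have := (hasDerivAt_const t v).inner ℝ (hX.hasDerivAt t ht i ⟨i + 1, hi⟩ rfl)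
    simpa using this.hasDerivWithinAt
  · rw [companion_last (by omega), hc', neg_sub]
    exact hX.hasDerivWithinAt_inner_last hI hI' hc ht hq (by omega)

lemma IsStateCurve.continuousOn_inner (hX : IsStateCurve I c X w) (v : E) :
    ContinuousOn (fun t (i : Fin m) => inner ℝ v (X t i)) I :=
  continuousOn_pi.2 fun i => continuousOn_const.inner (hX.continuousOn i)

lemma IsStateCurve.isRightSolution_of_isPast [CompleteSpace E]
    (hX : IsStateCurve I c X w) (hI : IsOpen I)
    (hI' : I.OrdConnected) (hc : ∀ i, ContinuousOn (c i) I) {a b : ℝ} (hab : Icc a b ⊆ I)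
    {u : E} (hu : IsPast I w a u) :
    IsRightSolution c a b (fun t i => inner ℝ u (X t i)) := by
  refine ⟨(hX.continuousOn_inner u).mono hab, fun t ht => ?_⟩
  have htI := hab ⟨ht.1, ht.2.le⟩
  refine hX.hasDerivWithinAt_inner hI hI' hc (q := 0) htI ?_ c (by ring)
  refine (hasDerivWithinAt_const t (Ici t) (0 : ℝ)).congr_of_eventuallyEq ?_ ?_
  · filter_upwards [self_mem_nhdsWithin, nhdsWithin_le_nhds (hI.mem_nhds htI)] with t' h3 h4
    exact hu t htI t' h4 ht.1 h3
  · exact hu t htI t htI ht.1 le_rfl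

variable {ψ : Fin m → ℝ → ℝ}

/-- The transition matrix of a fundamental system. -/
def transition (h : Fin m → ℝ → ℝ) (t s : ℝ) : Matrix (Fin m) (Fin m) ℝ :=
  wronskian h t * (wronskian h s)⁻¹

lemma IsFundamentalSystem.eq_transition_mulVec (hI : IsOpen I) (hI' : I.OrdConnected)
    (hc : ∀ i, ContinuousOn (c i) I) (hh : IsFundamentalSystem I c ψ) {a b : ℝ}
    (hab : Icc a b ⊆ I) {f : ℝ → Fin m → ℝ} (hf : IsRightSolution c a b f) {s t : ℝ}
    (hs : s ∈ Icc a b) (ht : t ∈ Icc a b) : f t = transition ψ t s *ᵥ f s := by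
  rw [transition, ← mulVec_mulVec, ← hh.propagation hI hI' hc hab hf hs ht, mulVec_mulVec,
    mul_nonsing_inv _ (hh.isUnit_det hI hI' hc (hab ht)), one_mulVec]

lemma IsStateCurve.inner_of_isPast [CompleteSpace E]
    (hX : IsStateCurve I c X w) (hI : IsOpen I)
    (hI' : I.OrdConnected) (hc : ∀ i, ContinuousOn (c i) I) (hψ : IsFundamentalSystem I c ψ)
    {s t : ℝ} (hs : s ∈ I) (ht : t ∈ I) (hst : s ≤ t) {u : E} (hu : IsPast I w s u) :
    (fun i => inner ℝ u (X t i)) = transition ψ t s *ᵥ fun i => inner ℝ u (X s i) :=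
  hψ.eq_transition_mulVec hI hI' hc (hI'.out hs ht)
    (hX.isRightSolution_of_isPast hI hI' hc (hI'.out hs ht) hu) ⟨le_rfl, hst⟩ ⟨hst, le_rfl⟩

lemma IsStateCurve.tendsto_noise (hX : IsStateCurve I c X w) (hI : IsOpen I) {t : ℝ}
    (ht : t ∈ I) : Tendsto (fun t' => w t t') (𝓝[>] t) (𝓝 0) := by
  rw [tendsto_zero_iff_norm_tendsto_zero]
  have h1 : Tendsto (fun t' => √(t' - t)) (𝓝[>] t) (𝓝 0) := by
    have : Continuous fun t' => √(t' - t) := by fun_prop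
    simpa using (this.tendsto t).mono_left nhdsWithin_le_nhds
  refine h1.congr' ?_
  filter_upwards [self_mem_nhdsWithin, nhdsWithin_le_nhds (hI.mem_nhds ht)] with t' h3 h4
  rw [norm_eq_sqrt_real_inner, hX.norm_noise t ht t' h4 (le_of_lt h3)]

/-- Correlation of the noise right after time `t` with the state right after time `t`. -/
lemma IsStateCurve.tendsto_inner_noise_state [CompleteSpace E]
    (hX : IsStateCurve I c X w) (hI : IsOpen I)
    (hc : ∀ i, ContinuousOn (c i) I) {t : ℝ} (ht : t ∈ I) (i : Fin m) :
    Tendsto (fun t' => (t' - t)⁻¹ * inner ℝ (w t t') (X t' i)) (𝓝[>] t) (𝓝 (noiseVec m i)) := by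
  have hw := hX.tendsto_noise hI ht
  have hgt : 𝓝[>] t ≤ 𝓝[≠] t := nhdsWithin_mono _ fun x hx => ne_of_gt hx
  -- The noise tends to zero in norm, so pairing it with a convergent difference quotient gives
  -- nothing in the limit. Only the squared norm `t' - t` of the noise, present in the last
  -- component, survives.
  have key : ∀ (S : ℝ → E) (S' : E), HasDerivAt S S' t →
      Tendsto (fun t' => inner ℝ (w t t') (slope S t t')) (𝓝[>] t) (𝓝 0) := by
    intro S S' hS
    have := hw.inner (𝕜 := ℝ) ((hasDerivAt_iff_tendsto_slope.1 hS).mono_left hgt)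
    rwa [inner_zero_left] at this
  have horth : ∀ t' ∈ I, t < t' → inner ℝ (w t t') (X t i) = 0 := fun t' h4 h3 => by
    rw [real_inner_comm]
    exact hX.orthogonal t ht t ht t' h4 le_rfl (le_of_lt h3) i
  by_cases hi : (i : ℕ) + 1 < m
  · have h0 : noiseVec m i = 0 := by simp [noiseVec, hi.ne]
    rw [h0]
    refine (key _ _ (hX.hasDerivAt t ht i ⟨i + 1, hi⟩ rfl)).congr' ?_
    filter_upwards [self_mem_nhdsWithin, nhdsWithin_le_nhds (hI.mem_nhds ht)] with t' h3 h4
    rw [slope_def_module, inner_smul_right, inner_sub_right, horth t' h4 h3, sub_zero]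
  · have him : (i : ℕ) + 1 = m := by omega
    have h0 : noiseVec m i = 1 := by simp [noiseVec, him]
    have h1 := key _ _ (hasDerivAt_integral_of_continuousOn hI (hX.continuousOn_drift hc) ht)
    have h2 := (tendsto_const_nhds (x := (1 : ℝ))).sub h1
    rw [sub_zero] at h2
    rw [h0]
    refine h2.congr' ?_
    filter_upwards [self_mem_nhdsWithin, nhdsWithin_le_nhds (hI.mem_nhds ht)] with t' h3 h4
    have h5 : X t' i = w t t' + X t i - ∫ u in t..t', ∑ i, c i u • X u i := by
      rw [← hX.equation t ht t' h4 (le_of_lt h3) i him]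
      abel
    have h6 : t' - t ≠ 0 := sub_ne_zero.2 (ne_of_gt h3)
    rw [h5, slope_def_module, inner_smul_right, inner_sub_right, inner_sub_right, inner_add_right,
      horth t' h4 h3, hX.norm_noise t ht t' h4 (le_of_lt h3), intervalIntegral.integral_same,
      inner_zero_right]
    field_simp
    ring

/-- Correlation of the noise right after time `t` with the state at a later time. -/
lemma IsStateCurve.hasDerivWithinAt_noise [CompleteSpace E]
    (hX : IsStateCurve I c X w) (hI : IsOpen I)
    (hI' : I.OrdConnected) (hc : ∀ i, ContinuousOn (c i) I) (hψ : IsFundamentalSystem I c ψ)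
    {t x : ℝ} (ht : t ∈ I) (hx : x ∈ I) (htx : t < x) (j : Fin m) :
    HasDerivWithinAt (fun t' => inner ℝ (X x j) (w t t'))
      ((transition ψ x t *ᵥ noiseVec m) j) (Ici t) t := by
  rw [← hasDerivWithinAt_Ioi_iff_Ici, hasDerivWithinAt_iff_tendsto_slope' self_notMem_Ioi]
  have hΦ : ∀ i, Tendsto (fun t' => transition ψ x t' j i) (𝓝[>] t) (𝓝 (transition ψ x t j i)) := by
    intro i
    have h1 := continuousOn_inv_of_isUnit_det (hψ.continuousOn_wronskian hI)
      fun t ht => hψ.isUnit_det hI hI' hc ht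
    have h2 : ContinuousOn (fun t' => ∑ k, wronskian ψ x j k * (wronskian ψ t')⁻¹ k i) I :=
      continuousOn_finsetSum _ fun k _ =>
        continuousOn_const.mul (continuousOn_pi.1 (continuousOn_pi.1 h1 k) i)
    exact (h2.continuousAt (hI.mem_nhds ht)).tendsto.mono_left nhdsWithin_le_nhds
  have hlim := tendsto_finsetSum Finset.univ fun i _ =>
    (hΦ i).mul (hX.tendsto_inner_noise_state hI hc ht i)
  refine hlim.congr' ?_
  filter_upwards [self_mem_nhdsWithin, nhdsWithin_le_nhds (hI.mem_nhds ht),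
    nhdsWithin_le_nhds (isOpen_Iio.mem_nhds htx)] with t' h3 h4 h5
  have hm : 1 ≤ m := j.pos
  -- At time `t'` the increment already belongs to the past, so its correlations with the state are
  -- carried from `t'` to `x` by the transition matrix.
  have h6 := congrFun (hX.inner_of_isPast hI hI' hc hψ h4 hx (le_of_lt h5)
    (hX.isPast_noise hI' hc hm ht h4 (le_of_lt h3))) j
  rw [slope_def_module, hX.noise_self ht, inner_zero_right, sub_zero, real_inner_comm, h6,
    smul_eq_mul, mulVec, dotProduct, Finset.mul_sum]
  exact Finset.sum_congr rfl fun i _ => by ring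

/-- Controllability with the invertible factor `wronskian ψ x` moved onto `v`. -/
lemma IsFundamentalSystem.eq_zero_of_transition (hI : IsOpen I)
    (hI' : I.OrdConnected) (hc : ∀ i, ContinuousOn (c i) I) (hψ : IsFundamentalSystem I c ψ)
    {a b x : ℝ} (hab : a < b) (hJ : Ioo a b ⊆ I) (hx : x ∈ I) {v : Fin m → ℝ}
    (H : ∀ t ∈ Ioo a b, (transition ψ x t *ᵥ noiseVec m) ⬝ᵥ v = 0) : v = 0 := by
  have h1 : v ᵥ* wronskian ψ x = 0 := by
    refine hψ.eq_zero_of_dotProduct hI hI' hc hab hJ fun t ht => ?_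
    rw [← dotProduct_mulVec, mulVec_mulVec, dotProduct_comm]
    exact H t ht
  have h2 := hψ.isUnit_det hI hI' hc hx
  rw [← vecMul_one v, ← mul_nonsing_inv _ h2, ← vecMul_vecMul, h1, zero_vecMul]

/-- A combination of the components of the state at time `x` that is orthogonal to the noise in an
interval before `x` is trivial. -/
lemma IsStateCurve.eq_zero_of_orthogonal_noise [CompleteSpace E]
    (hX : IsStateCurve I c X w) (hI : IsOpen I)
    (hI' : I.OrdConnected) (hc : ∀ i, ContinuousOn (c i) I) (hψ : IsFundamentalSystem I c ψ)
    {a b x : ℝ} (hab : a < b) (hJ : Ioo a b ⊆ I) (hbx : b ≤ x) (hx : x ∈ I) {v : Fin m → ℝ}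
    (H : ∀ t ∈ Ioo a b, ∀ t' ∈ Ioo a b, t ≤ t' → inner ℝ (∑ j, v j • X x j) (w t t') = 0) :
    v = 0 := by
  refine hψ.eq_zero_of_transition hI hI' hc hab hJ hx fun t ht => ?_
  have h1 : HasDerivWithinAt (fun t' => ∑ j, v j * inner ℝ (X x j) (w t t'))
      (∑ j, v j * (transition ψ x t *ᵥ noiseVec m) j) (Ici t) t :=
    HasDerivWithinAt.fun_sum fun j _ =>
      (hX.hasDerivWithinAt_noise hI hI' hc hψ (hJ ht) hx (ht.2.trans_le hbx) j).const_mul _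
  have h3 : ∀ t' ∈ Ioo a b, t ≤ t' → ∑ j, v j * inner ℝ (X x j) (w t t') = 0 := by
    intro t' h4 h5
    have := H t ht t' h4 h5
    simpa only [sum_inner, inner_smul_left, RCLike.conj_to_real] using this
  have h2 : HasDerivWithinAt (fun t' => ∑ j, v j * inner ℝ (X x j) (w t t')) 0 (Ici t) t := by
    refine (hasDerivWithinAt_const t (Ici t) (0 : ℝ)).congr_of_eventuallyEq ?_ (h3 t ht le_rfl)
    filter_upwards [self_mem_nhdsWithin, nhdsWithin_le_nhds (isOpen_Ioo.mem_nhds ht)] with t' h4 h5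
    exact h3 t' h5 h4
  have h4 := (uniqueDiffOn_Ici t t self_mem_Ici).eq_deriv _ h1 h2
  rw [dotProduct_comm]
  exact h4

lemma exists_Ioo_subset (hI : IsOpen I) {t : ℝ} (ht : t ∈ I) :
    ∃ a b, a < t ∧ t < b ∧ Ioo a b ⊆ I := by
  obtain ⟨ε, hε, h⟩ := Metric.isOpen_iff.1 hI t ht
  rw [Real.ball_eq_Ioo] at h
  exact ⟨_, _, by linarith, by linarith, h⟩

/-- A null vector of a Gram matrix gives a zero combination of the state, which is orthogonal to all
noise. -/
lemma IsStateCurve.isUnit_det_crossCov_self [CompleteSpace E]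
    (hX : IsStateCurve I c X w) (hI : IsOpen I)
    (hI' : I.OrdConnected) (hc : ∀ i, ContinuousOn (c i) I) (hψ : IsFundamentalSystem I c ψ)
    {t : ℝ} (ht : t ∈ I) : IsUnit (crossCov X t t).det := by
  rw [isUnit_iff_ne_zero]
  intro h0
  obtain ⟨v, hv, h1⟩ := Matrix.exists_mulVec_eq_zero_iff.2 h0
  refine hv ?_
  have hz : ∑ j, v j • X t j = 0 := by
    rw [← inner_self_eq_zero (𝕜 := ℝ), sum_inner]
    refine Finset.sum_eq_zero fun i _ => ?_
    rw [inner_smul_left, inner_sum]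
    have := congrFun h1 i
    simp only [mulVec, dotProduct, crossCov, Matrix.of_apply, Pi.zero_apply] at this
    simp only [inner_smul_right, mul_comm (v _), this, mul_zero]
  obtain ⟨a, b, hat, htb, hJ⟩ := exists_Ioo_subset hI ht
  refine hX.eq_zero_of_orthogonal_noise hI hI' hc hψ hat
    ((Ioo_subset_Ioo_right htb.le).trans hJ) le_rfl ht fun s _ s' _ _ => ?_
  rw [hz, inner_zero_left]

/-- Strict positive definiteness of the covariance function. -/
lemma IsStateCurve.eq_zero_of_sum_eq_zero [CompleteSpace E]
    (hX : IsStateCurve I c X w) (hI : IsOpen I)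
    (hI' : I.OrdConnected) (hc : ∀ i, ContinuousOn (c i) I) (hψ : IsFundamentalSystem I c ψ)
    (i : Fin m) (γ : ℝ → ℝ) (S : Finset ℝ) (hS : ∀ s ∈ S, s ∈ I)
    (h : ∑ s ∈ S, γ s • X s i = 0) : ∀ s ∈ S, γ s = 0 := by
  induction S using Finset.induction_on_max with
  | empty => simp
  | insert t S hmax ih =>
    have htS : t ∉ S := fun h => lt_irrefl _ (hmax t h)
    have htI := hS t (Finset.mem_insert_self _ _)
    have hSI : ∀ s ∈ S, s ∈ I := fun s hs => hS s (Finset.mem_insert_of_mem hs)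
    have hγ : γ t = 0 := by
      have hev : ∀ᶠ a in 𝓝[<] t, (∀ s ∈ S, s < a) ∧ a ∈ I :=
        ((Finset.eventually_all S).2 fun s hs =>
          nhdsWithin_le_nhds (isOpen_Ioi.mem_nhds (hmax s hs))).and
          (nhdsWithin_le_nhds (hI.mem_nhds htI))
      obtain ⟨a, ⟨haS, haI⟩, hat⟩ := (hev.and self_mem_nhdsWithin).exists
      have hJ : Ioo a t ⊆ I := Ioo_subset_Icc_self.trans (hI'.out haI htI)
      -- By `h` the term at the latest time `t` is a combination of states before `a`, hence
      -- orthogonal to the noise in `(a, t)`.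
      have hv := hX.eq_zero_of_orthogonal_noise hI hI' hc hψ (v := Pi.single i (γ t)) hat hJ
        le_rfl htI fun u hu u' hu' huu' => ?_
      · simpa using congrFun hv i
      · rw [Finset.sum_insert htS] at h
        have h1 : ∑ j, (Pi.single i (γ t) : Fin m → ℝ) j • X t j = γ t • X t i := by
          rw [Finset.sum_eq_single i (fun j _ hj => by simp [hj]) (by simp)]
          simp
        rw [h1, eq_neg_of_add_eq_zero_left h, inner_neg_left, sum_inner, neg_eq_zero]
        refine Finset.sum_eq_zero fun s hs => ?_
        rw [inner_smul_left, hX.orthogonal s (hSI s hs) u (hJ hu) u' (hJ hu')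
          ((haS s hs).le.trans hu.1.le) huu' i, mul_zero]
    rw [Finset.sum_insert htS, hγ, zero_smul, zero_add] at h
    intro s hs
    rcases Finset.mem_insert.1 hs with rfl | hs
    · exact hγ
    · exact ih hSI h s hs

lemma IsStateCurve.crossCov_eq [CompleteSpace E]
    (hX : IsStateCurve I c X w) (hI : IsOpen I)
    (hI' : I.OrdConnected) (hc : ∀ i, ContinuousOn (c i) I) (hψ : IsFundamentalSystem I c ψ)
    {s t : ℝ} (hs : s ∈ I) (ht : t ∈ I) (hst : s ≤ t) :
    crossCov X t s = transition ψ t s * crossCov X s s := by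
  ext i j
  have := congrFun (hX.inner_of_isPast hI hI' hc hψ hs ht hst (hX.isPast_state hs le_rfl j)) i
  rw [← transpose_crossCov s t, transpose_apply, crossCov, Matrix.of_apply, this,
    ← transpose_crossCov s s]
  rfl

lemma IsStateCurve.isUnit_det_crossCov [CompleteSpace E]
    (hX : IsStateCurve I c X w) (hI : IsOpen I)
    (hI' : I.OrdConnected) (hc : ∀ i, ContinuousOn (c i) I) (hψ : IsFundamentalSystem I c ψ)
    {s t : ℝ} (hs : s ∈ I) (ht : t ∈ I) : IsUnit (crossCov X t s).det := by
  wlog hst : s ≤ t generalizing s t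
  · rw [← transpose_crossCov, det_transpose]
    exact this ht hs (le_of_not_ge hst)
  rw [hX.crossCov_eq hI hI' hc hψ hs ht hst, transition, det_mul, det_mul]
  exact ((hψ.isUnit_det hI hI' hc ht).mul ((wronskian ψ s).isUnit_nonsing_inv_det
    (hψ.isUnit_det hI hI' hc hs))).mul (hX.isUnit_det_crossCov_self hI hI' hc hψ hs)

lemma IsStateCurve.continuousOn_crossCov (hX : IsStateCurve I c X w) :
    ContinuousOn (fun t => crossCov X t t) I :=
  continuousOn_pi.2 fun i => continuousOn_pi.2 fun j =>
    (hX.continuousOn i).inner (hX.continuousOn j)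

end StateCurve

/-! ### The backward equation and the two families of fundamental solutions -/

section Backward

variable {E : Type*} [NormedAddCommGroup E] [InnerProductSpace ℝ E]
  {m : ℕ} {I : Set ℝ} {c cb : Fin m → ℝ → ℝ} {X : ℝ → Fin m → E} {w : ℝ → ℝ → E}
  {ψ ζ : Fin m → ℝ → ℝ}

/-- `cb` are the coefficients of the backward equation of the state curve `X`. -/
def IsBackwardCoeff (I : Set ℝ) (c cb : Fin m → ℝ → ℝ) (X : ℝ → Fin m → E) : Prop :=
  ∀ t ∈ I, ∀ i, cb i t = c i t - (noiseVec m ᵥ* (crossCov X t t)⁻¹) i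

lemma IsStateCurve.continuousOn_backward [CompleteSpace E] (hX : IsStateCurve I c X w)
    (hI : IsOpen I) (hI' : I.OrdConnected) (hc : ∀ i, ContinuousOn (c i) I)
    (hψ : IsFundamentalSystem I c ψ) (hcb : IsBackwardCoeff I c cb X) (i : Fin m) :
    ContinuousOn (cb i) I := by
  have h1 := continuousOn_inv_of_isUnit_det hX.continuousOn_crossCov
    fun t ht => hX.isUnit_det_crossCov_self hI hI' hc hψ ht
  have h2 : ContinuousOn (fun t => c i t - ∑ k, noiseVec m k * (crossCov X t t)⁻¹ k i) I :=
    (hc i).sub (continuousOn_finsetSum _ fun k _ =>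
      continuousOn_const.mul (continuousOn_pi.1 (continuousOn_pi.1 h1 k) i))
  exact h2.congr fun t ht => hcb t ht i

/-- The covariance of the states at `x` and `t` is `Φ(x,t)Π(t)`, and `Π(t)` cancels. Thus the noise
rate is a linear functional of the current covariances, which is why they satisfy a closed backward
equation. -/
lemma IsStateCurve.noiseVec_dotProduct [CompleteSpace E] (hX : IsStateCurve I c X w)
    (hI : IsOpen I) (hI' : I.OrdConnected) (hc : ∀ i, ContinuousOn (c i) I)
    (hψ : IsFundamentalSystem I c ψ) {t x : ℝ} (ht : t ∈ I) (hx : x ∈ I) (htx : t ≤ x)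
    (j : Fin m) :
    (noiseVec m ᵥ* (crossCov X t t)⁻¹) ⬝ᵥ (fun i => inner ℝ (X x j) (X t i))
      = (transition ψ x t *ᵥ noiseVec m) j := by
  have hu := hX.isUnit_det_crossCov_self hI hI' hc hψ ht
  have h1 : (noiseVec m ᵥ* (crossCov X t t)⁻¹) ⬝ᵥ (fun i => inner ℝ (X x j) (X t i))
      = (crossCov X x t *ᵥ (noiseVec m ᵥ* (crossCov X t t)⁻¹)) j := by
    rw [dotProduct_comm]
    rfl
  rw [h1, hX.crossCov_eq hI hI' hc hψ ht hx htx, ← mulVec_transpose, transpose_nonsing_inv,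
    transpose_crossCov, mulVec_mulVec, Matrix.mul_assoc, mul_nonsing_inv _ hu, Matrix.mul_one]

/-- Correlations with the state at time `x` solve the backward equation before time `x`. -/
lemma IsStateCurve.isRightSolution_backward [CompleteSpace E] (hX : IsStateCurve I c X w)
    (hI : IsOpen I) (hI' : I.OrdConnected) (hc : ∀ i, ContinuousOn (c i) I)
    (hψ : IsFundamentalSystem I c ψ) (hcb : IsBackwardCoeff I c cb X) {a x : ℝ} (ha : a ∈ I)
    (hx : x ∈ I) (j : Fin m) :
    IsRightSolution cb a x (fun t i => inner ℝ (X x j) (X t i)) := by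
  have hsub : Icc a x ⊆ I := hI'.out ha hx
  refine ⟨(hX.continuousOn_inner _).mono hsub, fun t ht => ?_⟩
  have htI := hsub ⟨ht.1, ht.2.le⟩
  refine hX.hasDerivWithinAt_inner hI hI' hc htI
    (hX.hasDerivWithinAt_noise hI hI' hc hψ htI hx ht.2 j) cb ?_
  rw [← hX.noiseVec_dotProduct hI hI' hc hψ htI hx ht.2.le j, dotProduct,
    ← Finset.sum_sub_distrib]
  refine Finset.sum_congr rfl fun i _ => ?_
  rw [hcb t htI i]
  ring

/-- The coordinates of `K(x, ·)` with respect to a fundamental system `h`. -/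
def kernelCoeff (h : Fin m → ℝ → ℝ) (X : ℝ → Fin m → E) (i : Fin m) (x : ℝ) : Fin m → ℝ :=
  (wronskian h x)⁻¹ *ᵥ fun k => inner ℝ (X x i) (X x k)

lemma IsStateCurve.kernelCoeff_eq_forward [CompleteSpace E] (hX : IsStateCurve I c X w)
    (hI : IsOpen I) (hI' : I.OrdConnected) (hc : ∀ i, ContinuousOn (c i) I)
    (hψ : IsFundamentalSystem I c ψ) {t x : ℝ} (ht : t ∈ I) (hx : x ∈ I) (hxt : x ≤ t)
    (i : Fin m) :
    (wronskian ψ t)⁻¹ *ᵥ (fun k => inner ℝ (X x i) (X t k)) = kernelCoeff ψ X i x :=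
  hψ.propagation hI hI' hc (hI'.out hx ht)
    (hX.isRightSolution_of_isPast hI hI' hc (hI'.out hx ht) (hX.isPast_state hx le_rfl i))
    ⟨le_rfl, hxt⟩ ⟨hxt, le_rfl⟩

lemma IsStateCurve.kernelCoeff_eq_backward [CompleteSpace E] (hX : IsStateCurve I c X w)
    (hI : IsOpen I) (hI' : I.OrdConnected) (hc : ∀ i, ContinuousOn (c i) I)
    (hψ : IsFundamentalSystem I c ψ) (hcb : IsBackwardCoeff I c cb X)
    (hζ : IsFundamentalSystem I cb ζ) {t x : ℝ} (ht : t ∈ I) (hx : x ∈ I) (htx : t ≤ x)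
    (i : Fin m) :
    (wronskian ζ t)⁻¹ *ᵥ (fun k => inner ℝ (X x i) (X t k)) = kernelCoeff ζ X i x :=
  hζ.propagation hI hI' (hX.continuousOn_backward hI hI' hc hψ hcb) (hI'.out ht hx)
    (hX.isRightSolution_backward hI hI' hc hψ hcb ht hx i) ⟨htx, le_rfl⟩ ⟨le_rfl, htx⟩

lemma inner_eq_sum_of_coeff {h : Fin m → ℝ → ℝ} {t x : ℝ} {i : Fin m}
    (hu : IsUnit (wronskian h t).det) (hi : (i : ℕ) = 0) {α : Fin m → ℝ}
    (hα : (wronskian h t)⁻¹ *ᵥ (fun k => inner ℝ (X x i) (X t k)) = α) :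
    inner ℝ (X x i) (X t i) = ∑ k, α k * h k t := by
  have h1 : (fun k => inner ℝ (X x i) (X t k)) = wronskian h t *ᵥ α := by
    rw [← hα, mulVec_mulVec, mul_nonsing_inv _ hu, one_mulVec]
  rw [congrFun h1 i, wronskian_mulVec, hi]
  exact Finset.sum_congr rfl fun k _ => by rw [iteratedDeriv_zero, mul_comm]

/-- The components of the state are successive derivatives, and orthogonality to a fixed vector on
an open interval can be differentiated. -/
lemma IsStateCurve.inner_eq_zero_of_zeroth (hX : IsStateCurve I c X w) {a b : ℝ}
    (hJ : Ioo a b ⊆ I) {i₀ : Fin m} (hi₀ : (i₀ : ℕ) = 0) {z : E}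
    (hz : ∀ x ∈ Ioo a b, inner ℝ (X x i₀) z = 0) :
    ∀ i, ∀ x ∈ Ioo a b, inner ℝ (X x i) z = 0 := by
  have key : ∀ n : ℕ, ∀ i : Fin m, (i : ℕ) = n → ∀ x ∈ Ioo a b, inner ℝ (X x i) z = 0 := by
    intro n
    induction n with
    | zero =>
      intro i hi
      rwa [show i = i₀ from Fin.ext (by omega)]
    | succ n ih =>
      intro i hi x hx
      have h1 := (hX.hasDerivAt x (hJ hx) ⟨n, by omega⟩ i (by simp [hi])).inner ℝ
        (hasDerivAt_const x z)
      have h2 : HasDerivAt (fun x => inner ℝ (X x ⟨n, by omega⟩) z) 0 x :=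
        (hasDerivAt_const x (0 : ℝ)).congr_of_eventuallyEq (by
          filter_upwards [isOpen_Ioo.mem_nhds hx] with x' hx'
          exact ih ⟨n, by omega⟩ rfl x' hx')
      simpa using h1.unique h2
  exact fun i => key i i rfl

/-- The coordinates of `K(x, ·)` span as `x` varies in an interval. -/
lemma IsStateCurve.eq_zero_of_coeff [CompleteSpace E] (hX : IsStateCurve I c X w)
    (hI : IsOpen I) (hI' : I.OrdConnected) (hc : ∀ i, ContinuousOn (c i) I)
    (hψ : IsFundamentalSystem I c ψ) {h : Fin m → ℝ → ℝ} {t : ℝ} (ht : t ∈ I)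
    (hu : IsUnit (wronskian h t).det) {i : Fin m} (hi : (i : ℕ) = 0) {a b : ℝ} (hab : a < b)
    (hJ : Ioo a b ⊆ I) {γ : Fin m → ℝ}
    (hγ : ∀ x ∈ Ioo a b,
      γ ⬝ᵥ ((wronskian h t)⁻¹ *ᵥ (fun k => inner ℝ (X x i) (X t k))) = 0) : γ = 0 := by
  -- With `g`, the assumption says that `X x i` is orthogonal to a fixed combination of the state at
  -- `t`; differentiating in `x` reaches the whole state, and the cross-covariance is invertible.
  set g := γ ᵥ* (wronskian h t)⁻¹ with hg
  have h1 : ∀ x ∈ Ioo a b, inner ℝ (X x i) (∑ k, g k • X t k) = 0 := by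
    intro x hx
    have := hγ x hx
    rw [dotProduct_mulVec] at this
    simp only [inner_sum, inner_smul_right]
    exact this
  have h2 := hX.inner_eq_zero_of_zeroth hJ hi h1
  obtain ⟨x, hx⟩ := nonempty_Ioo.2 hab
  have h3 : crossCov X x t *ᵥ g = 0 := by
    funext j
    have := h2 j x hx
    simp only [inner_sum, inner_smul_right] at this
    simpa [mulVec, dotProduct, crossCov, mul_comm] using this
  have h4 := hX.isUnit_det_crossCov hI hI' hc hψ ht (hJ hx)
  have h5 : g = 0 := by
    rw [← one_mulVec g, ← nonsing_inv_mul _ h4, ← mulVec_mulVec, h3, mulVec_zero]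
  rw [← vecMul_one γ, ← nonsing_inv_mul _ hu, ← vecMul_vecMul, ← hg, h5, zero_vecMul]

/-- Forward and backward fundamental solutions are jointly linearly independent on every
interval. -/
lemma IsStateCurve.eq_zero_of_sum_fundamental [CompleteSpace E] (hX : IsStateCurve I c X w)
    (hI : IsOpen I) (hI' : I.OrdConnected) (hc : ∀ i, ContinuousOn (c i) I)
    (hψ : IsFundamentalSystem I c ψ) (hcb : IsBackwardCoeff I c cb X)
    (hζ : IsFundamentalSystem I cb ζ) {a b : ℝ} (hab : a < b) (hJ : Ioo a b ⊆ I)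
    {α β : Fin m → ℝ} (h : ∀ t ∈ Ioo a b, ∑ k, α k * ψ k t + ∑ k, β k * ζ k t = 0) :
    α = 0 ∧ β = 0 := by
  have hccb := hX.continuousOn_backward hI hI' hc hψ hcb
  have hdA := fun t (ht : t ∈ Ioo a b) => hψ.hasDerivAt hI α (hJ ht)
  have hdB := fun t (ht : t ∈ Ioo a b) => hζ.hasDerivAt hI β (hJ ht)
  have hd : ∀ t ∈ Ioo a b, ∀ i, HasDerivAt (fun t => (wronskian ψ t *ᵥ α + wronskian ζ t *ᵥ β) i)
      (companion c t (wronskian ψ t *ᵥ α) i + companion cb t (wronskian ζ t *ᵥ β) i) t :=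
    fun t ht i => hasDerivAt_pi.1 ((hdA t ht).add (hdB t ht)) i
  have hd0 : ∀ i, (∀ t ∈ Ioo a b, (wronskian ψ t *ᵥ α + wronskian ζ t *ᵥ β) i = 0) →
      ∀ t ∈ Ioo a b, companion c t (wronskian ψ t *ᵥ α) i
        + companion cb t (wronskian ζ t *ᵥ β) i = 0 := by
    intro i hi t ht
    refine (hd t ht i).unique ((hasDerivAt_const t (0 : ℝ)).congr_of_eventuallyEq ?_)
    filter_upwards [isOpen_Ioo.mem_nhds ht] with t' ht'
    exact hi t' ht'
  have key : ∀ n : ℕ, ∀ i : Fin m, (i : ℕ) = n → ∀ t ∈ Ioo a b,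
      (wronskian ψ t *ᵥ α + wronskian ζ t *ᵥ β) i = 0 := by
    intro n
    induction n with
    | zero =>
      intro i hi t ht
      have := h t ht
      simpa [wronskian_mulVec, hi, mul_comm] using this
    | succ n ih =>
      intro i hi t ht
      have := hd0 ⟨n, by omega⟩ (ih ⟨n, by omega⟩ rfl) t ht
      rwa [companion_of_succ (j := i) (by simp [hi]),
        companion_of_succ (j := i) (by simp [hi])] at this
  have hsum : ∀ t ∈ Ioo a b, wronskian ζ t *ᵥ β = -(wronskian ψ t *ᵥ α) := fun t ht =>
    eq_neg_of_add_eq_zero_right (funext fun i => key i i rfl t ht)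
  -- The two state vectors are opposite, so adding the two equations of order `m` leaves only the
  -- difference of the operators.
  have hBA : ∀ t ∈ Ioo a b, (noiseVec m ᵥ* (crossCov X t t)⁻¹) ⬝ᵥ (wronskian ψ t *ᵥ α) = 0 := by
    intro t ht
    rcases Nat.eq_zero_or_pos m with rfl | hm
    · simp
    have hl : ((⟨m - 1, by omega⟩ : Fin m) : ℕ) + 1 = m := Nat.sub_add_cancel hm
    have h1 := hd0 ⟨m - 1, by omega⟩ (key _ _ rfl) t ht
    rw [companion_last hl, companion_last hl, hsum t ht, ← neg_add, neg_eq_zero,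
      ← Finset.sum_add_distrib] at h1
    rw [dotProduct, ← h1]
    refine Finset.sum_congr rfl fun i _ => ?_
    rw [hcb t (hJ ht) i, Pi.neg_apply]
    ring
  obtain ⟨x, hx⟩ := nonempty_Ioo.2 hab
  have hxI := hJ hx
  have hux := hX.isUnit_det_crossCov_self hI hI' hc hψ hxI
  set g := (crossCov X x x)⁻¹ *ᵥ (wronskian ψ x *ᵥ α) with hg
  have hgx : crossCov X x x *ᵥ g = wronskian ψ x *ᵥ α := by
    rw [hg, mulVec_mulVec, mul_nonsing_inv _ hux, one_mulVec]
  -- Being minus a `ζ`-combination, the left side also solves the backward system, as do the columns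
  -- of `crossCov X t x`. The choice of `g` makes the two sides agree at `x`.
  have hA : ∀ t ∈ Ioo a x, wronskian ψ t *ᵥ α = crossCov X t x *ᵥ g := by
    intro t ht
    have htJ : t ∈ Ioo a b := ⟨ht.1, ht.2.trans hx.2⟩
    have hcol : crossCov X t x = transition ζ t x * crossCov X x x := by
      ext i j
      have := congrFun (hζ.eq_transition_mulVec hI hI' hccb (hI'.out (hJ htJ) hxI)
        (hX.isRightSolution_backward hI hI' hc hψ hcb (hJ htJ) hxI j)
        ⟨ht.2.le, le_rfl⟩ ⟨le_rfl, ht.2.le⟩) i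
      rw [← transpose_crossCov x t, transpose_apply, crossCov, Matrix.of_apply, this,
        ← transpose_crossCov x x]
      rfl
    rw [hcol, ← mulVec_mulVec, hgx, ← neg_neg (wronskian ψ x *ᵥ α), ← hsum x hx, mulVec_neg,
      transition, mulVec_mulVec, Matrix.mul_assoc,
      nonsing_inv_mul _ (hζ.isUnit_det hI hI' hccb hxI), Matrix.mul_one, hsum t htJ, neg_neg]
  -- On covariances with the state at `x` the functional in `hBA` equals `Φ(x,t)B`, so `g` is
  -- orthogonal to `Φ(x,t)B` for `t` in `(a, x)` and controllability applies.
  have hg0 : g = 0 := by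
    refine hψ.eq_zero_of_transition hI hI' hc hx.1
      ((Ioo_subset_Ioo_right hx.2.le).trans hJ) hxI fun t ht => ?_
    have htJ : t ∈ Ioo a b := ⟨ht.1, ht.2.trans hx.2⟩
    have h1 := hBA t htJ
    rw [hA t ht, dotProduct_mulVec] at h1
    rw [← h1]
    congr 1
    funext j
    rw [← hX.noiseVec_dotProduct hI hI' hc hψ (hJ htJ) hxI ht.2.le j, ← transpose_crossCov x t,
      vecMul_transpose, dotProduct_comm]
    rfl
  have hψα : wronskian ψ x *ᵥ α = 0 := by rw [← hgx, hg0, mulVec_zero]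
  have hζβ : wronskian ζ x *ᵥ β = 0 := by rw [hsum x hx, hψα, neg_zero]
  constructor
  · rw [← one_mulVec α, ← nonsing_inv_mul _ (hψ.isUnit_det hI hI' hc hxI), ← mulVec_mulVec, hψα,
      mulVec_zero]
  · rw [← one_mulVec β, ← nonsing_inv_mul _ (hζ.isUnit_det hI hI' hccb hxI), ← mulVec_mulVec, hζβ,
      mulVec_zero]

end Backward

/-! ### Summary for one coordinate -/

/-- The properties of the covariance function `K` on `I` and of a system of functions `H` that
determine the kernel packets: `H` is continuous and linearly independent on every interval; `K(x, ·)`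
can be expanded in `H` on either side of `x`, with coordinates that span as `x` varies in an
interval; and `K` is strictly positive definite. -/
structure IsPacketSystem {m : ℕ} (I : Set ℝ) (K : ℝ → ℝ → ℝ) (H : Fin m ⊕ Fin m → ℝ → ℝ)
    (α β : ℝ → Fin m → ℝ) : Prop where
  continuousOn : ∀ k, ContinuousOn (H k) I
  expand_right : ∀ x ∈ I, ∀ t ∈ I, t < x → K x t = ∑ k, α x k * H (Sum.inr k) t
  expand_left : ∀ x ∈ I, ∀ t ∈ I, x < t → K x t = ∑ k, β x k * H (Sum.inl k) t
  span_right : ∀ a b, a < b → Ioo a b ⊆ I → ∀ γ : Fin m → ℝ,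
    (∀ x ∈ Ioo a b, ∑ k, γ k * α x k = 0) → γ = 0
  span_left : ∀ a b, a < b → Ioo a b ⊆ I → ∀ γ : Fin m → ℝ,
    (∀ x ∈ Ioo a b, ∑ k, γ k * β x k = 0) → γ = 0
  linearIndependent : ∀ a b, a < b → Ioo a b ⊆ I → ∀ γ : Fin m ⊕ Fin m → ℝ,
    (∀ x ∈ Ioo a b, ∑ k, γ k * H k x = 0) → γ = 0
  posDef : ∀ (S : Finset ℝ) (γ : ℝ → ℝ), (∀ s ∈ S, s ∈ I) →
    (∀ x ∈ S, ∑ s ∈ S, γ s * K x s = 0) → ∀ s ∈ S, γ s = 0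

/-- The covariance function of a solution of the forward equation, with forward and backward
fundamental solutions. -/
theorem IsForwardSolution.isPacketSystem {Ω : Type*} [MeasurableSpace Ω] {P : Measure Ω}
    [IsProbabilityMeasure P] {m : ℕ} (hm : 1 ≤ m) {I : Set ℝ} {c : Fin m → ℝ → ℝ}
    {W y : ℝ → Ω → ℝ} (hy : IsForwardSolution I c P W y) (hI : IsOpen I) (hI' : I.OrdConnected)
    (hc : ∀ i, ContinuousOn (c i) I) {ψ ζ : Fin m → ℝ → ℝ} (hψ : IsFundamentalSystem I c ψ)
    (hζ : IsFundamentalSystem I (backwardCoeff c P y) ζ) :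
    IsPacketSystem I (kernel P y) (Sum.elim ψ ζ)
      (kernelCoeff ζ (stateL2 m P y) ⟨0, hm⟩) (kernelCoeff ψ (stateL2 m P y) ⟨0, hm⟩) := by
  have hX := hy.isStateCurve hI hI' hc
  have hcb : IsBackwardCoeff I c (backwardCoeff c P y) (stateL2 m P y) := by
    intro t ht i
    have : stateCov m P y t = crossCov (stateL2 m P y) t t := by
      ext i j
      exact hy.stateCov_eq_inner ht i j
    rw [backwardCoeff, this]
  have hccb := hX.continuousOn_backward hI hI' hc hψ hcb
  have hK : ∀ s ∈ I, ∀ t ∈ I, kernel P y s t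
      = inner ℝ (stateL2 m P y s ⟨0, hm⟩) (stateL2 m P y t ⟨0, hm⟩) :=
    fun s hs t ht => hy.kernel_eq_inner ⟨0, hm⟩ rfl hs ht
  refine ⟨?_, ?_, ?_, ?_, ?_, ?_, ?_⟩
  · rintro (k | k)
    · exact (hψ.1 k).1.continuousOn
    · exact (hζ.1 k).1.continuousOn
  · intro x hx t ht htx
    rw [hK x hx t ht]
    exact inner_eq_sum_of_coeff (hζ.isUnit_det hI hI' hccb ht) rfl
      (hX.kernelCoeff_eq_backward hI hI' hc hψ hcb hζ ht hx htx.le _)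
  · intro x hx t ht hxt
    rw [hK x hx t ht]
    exact inner_eq_sum_of_coeff (hψ.isUnit_det hI hI' hc ht) rfl
      (hX.kernelCoeff_eq_forward hI hI' hc hψ ht hx hxt.le _)
  · intro a b hab hJ γ hγ
    obtain ⟨t, ht⟩ := nonempty_Ioo.2 hab
    refine hX.eq_zero_of_coeff hI hI' hc hψ (hJ ht) (hζ.isUnit_det hI hI' hccb (hJ ht))
      (i := ⟨0, hm⟩) rfl ht.2 ((Ioo_subset_Ioo_left ht.1.le).trans hJ) fun x hx => ?_
    have hxJ : x ∈ Ioo a b := ⟨ht.1.trans hx.1, hx.2⟩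
    rw [hX.kernelCoeff_eq_backward hI hI' hc hψ hcb hζ (hJ ht) (hJ hxJ) hx.1.le]
    exact hγ x hxJ
  · intro a b hab hJ γ hγ
    obtain ⟨t, ht⟩ := nonempty_Ioo.2 hab
    refine hX.eq_zero_of_coeff hI hI' hc hψ (hJ ht) (hψ.isUnit_det hI hI' hc (hJ ht))
      (i := ⟨0, hm⟩) rfl ht.1 ((Ioo_subset_Ioo_right ht.2.le).trans hJ) fun x hx => ?_
    have hxJ : x ∈ Ioo a b := ⟨hx.1, hx.2.trans ht.2⟩
    rw [hX.kernelCoeff_eq_forward hI hI' hc hψ (hJ ht) (hJ hxJ) hx.2.le]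
    exact hγ x hxJ
  · intro a b hab hJ γ hγ
    have := hX.eq_zero_of_sum_fundamental hI hI' hc hψ hcb hζ hab hJ
      (α := fun k => γ (Sum.inl k)) (β := fun k => γ (Sum.inr k)) fun t ht => by
        simpa [Fintype.sum_sum_type] using hγ t ht
    funext k
    rcases k with k | k
    · exact congrFun this.1 k
    · exact congrFun this.2 k
  · intro S γ hS h
    refine hX.eq_zero_of_sum_eq_zero hI hI' hc hψ ⟨0, hm⟩ γ S hS ?_
    rw [← inner_self_eq_zero (𝕜 := ℝ), sum_inner]
    refine Finset.sum_eq_zero fun x hx => ?_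
    have h1 := h x hx
    rw [Finset.sum_congr rfl fun s hs => by rw [hK x (hS x hx) s (hS s hs)]] at h1
    rw [inner_smul_left, inner_sum]
    simp only [inner_smul_right, h1, mul_zero]

/-! ### Tensor products of separating families -/

/-- Freeze the first variable, use induction in the others, then separate in the first. It serves
three times: for coefficient vectors, for Gram matrices, and for the functions `H` themselves. -/
lemma eq_zero_of_tensor {D : ℕ} {κ : Fin D → Type} [∀ d, Fintype (κ d)] {A : Fin D → Set ℝ}
    (f : ∀ d, ℝ → κ d → ℝ)
    (hf : ∀ d, ∀ γ : κ d → ℝ, (∀ x ∈ A d, ∑ k, γ k * f d x k = 0) → γ = 0)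
    (b : (∀ d, κ d) → ℝ)
    (h : ∀ x : Fin D → ℝ, (∀ d, x d ∈ A d) → ∑ k, b k * ∏ d, f d (x d) (k d) = 0) : b = 0 := by
  induction D with
  | zero =>
    have := h 0 (fun d => d.elim0)
    simp only [Finset.univ_eq_empty, Finset.prod_empty, mul_one] at this
    funext k
    rw [Fintype.sum_eq_single k (fun k' hk' => (hk' (Subsingleton.elim _ _)).elim)] at this
    exact this
  | succ D ih =>
    have h1 : ∀ x₀ ∈ A 0, (fun k' : ∀ d : Fin D, κ d.succ =>
        ∑ k₀, b (Fin.cons k₀ k') * f 0 x₀ k₀) = 0 := by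
      intro x₀ hx₀
      refine ih (A := fun d => A d.succ) (fun d => f d.succ) (fun d => hf d.succ) _ fun x hx => ?_
      have := h (Fin.cons x₀ x) (Fin.cases hx₀ hx)
      rw [← (Fin.consEquiv κ).sum_comp, Fintype.sum_prod_type_right] at this
      rw [← this]
      refine Finset.sum_congr rfl fun k' _ => ?_
      rw [Finset.sum_mul]
      refine Finset.sum_congr rfl fun k₀ _ => ?_
      rw [Fin.prod_univ_succ]
      simp [Fin.consEquiv, mul_assoc]
    funext k
    have h2 := hf 0 (fun k₀ => b (Fin.cons k₀ (Fin.tail k))) fun x₀ hx₀ =>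
      congrFun (h1 x₀ hx₀) (Fin.tail k)
    have := congrFun h2 (k 0)
    simpa using this

/-! ### Vectors in general position -/

section GeneralPosition

variable {X : Type*} {M : ℕ}

/-- Configurations of `M + 1` points in `U` such that the values of `T` at any `M` of them are
linearly independent. -/
def generalSet (U : Set X) (T : X → Fin M → ℝ) : Set (Fin (M + 1) → X) :=
  {t | (∀ i, t i ∈ U) ∧ ∀ i₀ : Fin (M + 1), (Matrix.of fun j => T (t (i₀.succAbove j))).det ≠ 0}

lemma eq_zero_of_mem_generalSet {U : Set X} {T : X → Fin M → ℝ} {t : Fin (M + 1) → X}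
    (ht : t ∈ generalSet U T) {a : Fin (M + 1) → ℝ} (ha : ∑ i, a i • T (t i) = 0)
    {i₀ : Fin (M + 1)} (h0 : a i₀ = 0) : a = 0 := by
  have h1 : (fun j => a (i₀.succAbove j)) ᵥ* (Matrix.of fun j => T (t (i₀.succAbove j))) = 0 := by
    rw [Fin.sum_univ_succAbove _ i₀, h0, zero_smul, zero_add] at ha
    funext k
    have := congrFun ha k
    simpa [vecMul, dotProduct, Finset.sum_apply] using this
  have h2 := Matrix.eq_zero_of_vecMul_eq_zero (ht.2 i₀) h1
  funext i
  rcases Fin.eq_self_or_eq_succAbove i₀ i with rfl | ⟨j, rfl⟩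
  · exact h0
  · exact congrFun h2 j

/-- Two equal points would give the relation with coefficients `1` and `-1`. As `M + 1 ≥ 3`, it has
a zero coefficient elsewhere, which general position forbids. -/
lemma injective_of_mem_generalSet (hM : 2 ≤ M) {U : Set X} {T : X → Fin M → ℝ}
    {t : Fin (M + 1) → X} (ht : t ∈ generalSet U T) : Function.Injective t := by
  intro i j hij
  by_contra hne
  obtain ⟨k, -, hk⟩ := Finset.exists_mem_notMem_of_card_lt_card
    (s := {i, j}) (t := (Finset.univ : Finset (Fin (M + 1))))
    (Finset.card_le_two.trans_lt (by simp; omega))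
  simp only [Finset.mem_insert, Finset.mem_singleton, not_or] at hk
  have h1 : ∑ q, (Pi.single i 1 - Pi.single j 1 : Fin (M + 1) → ℝ) q • T (t q) = 0 := by
    simp only [Pi.sub_apply, sub_smul, Finset.sum_sub_distrib]
    rw [Fintype.sum_eq_single i (fun q hq => by simp [hq]),
      Fintype.sum_eq_single j (fun q hq => by simp [hq])]
    simp [hij]
  have := congrFun (eq_zero_of_mem_generalSet ht h1 (i₀ := k) (by simp [hk.1, hk.2])) i
  simp [hne] at this

variable [TopologicalSpace X]

lemma isOpen_det_ne_zero {U : Set X} (hU : IsOpen U) {T : X → Fin M → ℝ}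
    (hT : ContinuousOn T U) (i₀ : Fin (M + 1)) :
    IsOpen {t : Fin (M + 1) → X | (∀ i, t i ∈ U) ∧
      (Matrix.of fun j => T (t (i₀.succAbove j))).det ≠ 0} := by
  have hW : IsOpen {t : Fin (M + 1) → X | ∀ i, t i ∈ U} := by
    simp only [ofPred_forall]
    exact isOpen_iInter_of_finite fun i => hU.preimage (continuous_apply i)
  have hc : ContinuousOn (fun t : Fin (M + 1) → X =>
      (Matrix.of fun j => T (t (i₀.succAbove j)) : Matrix (Fin M) (Fin M) ℝ))
      {t | ∀ i, t i ∈ U} :=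
    continuousOn_pi.2 fun j => hT.comp (continuous_apply _).continuousOn fun t ht => ht _
  exact ((continuous_id.matrix_det).comp_continuousOn hc).isOpen_inter_preimage hW
    (isOpen_compl_singleton (x := (0 : ℝ)))

lemma isOpen_generalSet {U : Set X} (hU : IsOpen U) {T : X → Fin M → ℝ}
    (hT : ContinuousOn T U) : IsOpen (generalSet U T) := by
  have : generalSet U T = ⋂ i₀ : Fin (M + 1), {t | (∀ i, t i ∈ U) ∧
      (Matrix.of fun j => T (t (i₀.succAbove j))).det ≠ 0} := by
    ext t
    simp only [generalSet, mem_ofPred_eq, mem_iInter]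
    exact ⟨fun h i₀ => ⟨h.1, h.2 i₀⟩, fun h => ⟨(h 0).1, fun i₀ => (h i₀).2⟩⟩
  rw [this]
  exact isOpen_iInter_of_finite fun i₀ => isOpen_det_ne_zero hU hT i₀

/-- `T` is separating on every nonempty open subset of `U`. -/
def IsLocallySeparating (U : Set X) (T : X → Fin M → ℝ) : Prop :=
  ∀ O ⊆ U, IsOpen O → O.Nonempty → ∀ γ : Fin M → ℝ, (∀ x ∈ O, ∑ k, γ k * T x k = 0) → γ = 0

/-- Greedy choice: fewer than `M` vectors lie in the kernel of a nonzero functional, which by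
separation cannot kill `T` on all of the next open set. -/
lemma IsLocallySeparating.exists_linearIndependent {U : Set X} {T : X → Fin M → ℝ}
    (hT : IsLocallySeparating U T) {O : ℕ → Set X}
    (hO : ∀ n < M, O n ⊆ U ∧ IsOpen (O n) ∧ (O n).Nonempty) {k : ℕ} (hk : k ≤ M) :
    ∃ t : Fin k → X, (∀ j : Fin k, t j ∈ O j) ∧ LinearIndependent ℝ (fun j => T (t j)) := by
  induction k with
  | zero => exact ⟨Fin.elim0, fun j => j.elim0, linearIndependent_empty_type⟩
  | succ k ih =>
    obtain ⟨t, ht, hli⟩ := ih (by omega)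
    obtain ⟨hOU, hOo, hOn⟩ := hO k (by omega)
    obtain ⟨x, hx, hxs⟩ : ∃ x ∈ O k, T x ∉ Submodule.span ℝ (range fun j => T (t j)) := by
      by_contra! hcon
      have hlt : Submodule.span ℝ (range fun j => T (t j)) < ⊤ := by
        rw [lt_top_iff_ne_top]
        intro htop
        have h1 := finrank_range_le_card (R := ℝ) (fun j => T (t j))
        rw [Set.finrank, htop, finrank_top] at h1
        simp at h1
        omega
      obtain ⟨f, hf, hle⟩ := Submodule.exists_le_ker_of_lt_top _ hlt
      refine hf (LinearMap.pi_ext' fun i => LinearMap.ext_ring ?_)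
      have h2 := hT (O k) hOU hOo hOn (fun i => f (Pi.single i 1)) fun x hx => by
        have h3 : f (T x) = 0 := hle (hcon x hx)
        rw [LinearMap.pi_apply_eq_sum_univ] at h3
        rw [← h3]
        refine Finset.sum_congr rfl fun i _ => ?_
        rw [smul_eq_mul, mul_comm]
        congr 2
        funext j
        simp [Pi.single_apply, eq_comm]
      simpa using congrFun h2 i
    refine ⟨Fin.snoc t x, fun j => ?_, ?_⟩
    · refine Fin.lastCases ?_ (fun j => ?_) j
      · simpa using hx
      · simpa using ht j
    · have : (fun j => T ((Fin.snoc t x : Fin (k + 1) → X) j))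
          = Fin.snoc (fun j => T (t j)) (T x) := by
        funext j
        refine Fin.lastCases ?_ (fun j => ?_) j <;> simp
      rw [this]
      exact hli.finSnoc hxs

lemma IsLocallySeparating.subset_closure {U : Set X} (hU : IsOpen U) {T : X → Fin M → ℝ}
    (hTc : ContinuousOn T U) (hT : IsLocallySeparating U T) :
    {t : Fin (M + 1) → X | ∀ i, t i ∈ U} ⊆ closure (generalSet U T) := by
  have hW : IsOpen {t : Fin (M + 1) → X | ∀ i, t i ∈ U} := by
    simp only [ofPred_forall]
    exact isOpen_iInter_of_finite fun i => hU.preimage (continuous_apply i)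
  have key : ∀ F : Finset (Fin (M + 1)), ∀ O : Set (Fin (M + 1) → X), IsOpen O → O.Nonempty →
      O ⊆ {t | ∀ i, t i ∈ U} → ∃ O' ⊆ O, IsOpen O' ∧ O'.Nonempty ∧ ∀ t ∈ O', ∀ i₀ ∈ F,
        (Matrix.of fun j => T (t (i₀.succAbove j))).det ≠ 0 := by
    intro F
    induction F using Finset.induction_on with
    | empty => exact fun O hO hne _ => ⟨O, Subset.rfl, hO, hne, by simp⟩
    | insert i₀ F _ ih =>
      intro O hO hne hOU
      obtain ⟨O', hO'O, hO', ⟨u, hu⟩, hdet⟩ := ih O hO hne hOU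
      obtain ⟨B, hB, hBO⟩ := isOpen_pi_iff'.1 hO' u hu
      have huU : ∀ i, u i ∈ U := hOU (hO'O hu)
      -- Point `i₀` stays at `u i₀` and the other `M` points move within the box. The value `U` for
      -- `n ≥ M` is a dummy.
      set C : ℕ → Set X := fun n => if h : n < M then B (i₀.succAbove ⟨n, h⟩) ∩ U else U with hC
      obtain ⟨t, ht, hli⟩ := hT.exists_linearIndependent (O := C) (k := M) (fun n hn => by
        simp only [hC, dif_pos hn]
        exact ⟨inter_subset_right, (hB _).1.inter hU, _, (hB _).2, huU _⟩) le_rfl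
      have ht' : ∀ j, t j ∈ B (i₀.succAbove j) ∩ U := fun j => by
        have := ht j
        simpa only [hC, dif_pos j.2] using this
      refine ⟨O' ∩ {t | (∀ i, t i ∈ U) ∧
        (Matrix.of fun j => T (t (i₀.succAbove j))).det ≠ 0}, fun _ h => hO'O h.1,
        hO'.inter (isOpen_det_ne_zero hU hTc i₀), ⟨i₀.insertNth (u i₀) t, hBO ?_, ?_, ?_⟩, ?_⟩
      · intro i _
        rcases Fin.eq_self_or_eq_succAbove i₀ i with rfl | ⟨j, rfl⟩
        · simpa using (hB _).2
        · simpa using (ht' j).1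
      · intro i
        rcases Fin.eq_self_or_eq_succAbove i₀ i with rfl | ⟨j, rfl⟩
        · simpa using huU _
        · simpa using (ht' j).2
      · simp only [Fin.insertNth_apply_succAbove]
        have := Matrix.linearIndependent_rows_iff_isUnit.1
          (show LinearIndependent ℝ (Matrix.of fun j => T (t j)).row from hli)
        exact ((Matrix.isUnit_iff_isUnit_det _).1 this).ne_zero
      · rintro s ⟨hs, hs'⟩ i hi
        rcases Finset.mem_insert.1 hi with rfl | hi
        · exact hs'.2
        · exact hdet s hs i hi
  intro t ht
  rw [mem_closure_iff]
  intro O hO htO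
  obtain ⟨O', hO', -, ⟨s, hs⟩, hdet⟩ := key Finset.univ (O ∩ {t | ∀ i, t i ∈ U}) (hO.inter hW)
    ⟨t, htO, ht⟩ inter_subset_right
  exact ⟨s, (hO' hs).1, (hO' hs).2, fun i₀ => hdet s hs i₀ (Finset.mem_univ _)⟩

end GeneralPosition

/-! ### Kernel packets -/

section Packets

variable {D m : ℕ} {I : Fin D → Set ℝ} {K : Fin D → ℝ → ℝ → ℝ}
  {H : Fin D → Fin m ⊕ Fin m → ℝ → ℝ} {α β : Fin D → ℝ → Fin m → ℝ}

/-- The tensor product of the systems `H d`. -/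
def tensorFn (H : Fin D → Fin m ⊕ Fin m → ℝ → ℝ) (x : Fin D → ℝ)
    (k : Fin D → Fin m ⊕ Fin m) : ℝ :=
  ∏ d, H d (k d) (x d)

lemma tensorVec_eq_tensorFn (ψ ζ : Fin D → Fin m → ℝ → ℝ) :
    tensorVec ψ ζ = tensorFn fun d => Sum.elim (ψ d) (ζ d) := by
  funext x k
  refine Finset.prod_congr rfl fun d _ => ?_
  rw [solutionVec]
  rcases k d with i | i <;> rfl

lemma solvesSystem_iff {n : ℕ} {κ : Type*} {T : (Fin D → ℝ) → κ → ℝ} {t : Fin n → Fin D → ℝ}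
    {a : Fin n → ℝ} : SolvesSystem T t a ↔ ∀ k, ∑ i, a i * T (t i) k = 0 := by
  rw [SolvesSystem, funext_iff]
  simp [Finset.sum_apply]

open Classical in
/-- The coordinates of `K(x, ·)` with respect to `H`, valid at points all on one side of `x`. -/
def sideCoeff {n : ℕ} (α β : ℝ → Fin m → ℝ) (s : Fin n → ℝ) (x : ℝ) : Fin m ⊕ Fin m → ℝ :=
  if ∀ i, x < s i then Sum.elim (β x) 0 else Sum.elim 0 (α x)

lemma IsPacketSystem.eq_sum_sideCoeff {I : Set ℝ} {K : ℝ → ℝ → ℝ} {H : Fin m ⊕ Fin m → ℝ → ℝ}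
    {α β : ℝ → Fin m → ℝ} (h : IsPacketSystem I K H α β) {n : ℕ} {s : Fin n → ℝ}
    (hs : ∀ i, s i ∈ I) {x : ℝ} (hx : x ∈ I) (hxs : (∀ i, x < s i) ∨ ∀ i, s i < x) (i : Fin n) :
    K x (s i) = ∑ k, sideCoeff α β s x k * H k (s i) := by
  rw [sideCoeff, Fintype.sum_sum_type]
  split_ifs with hlt
  · simpa using h.expand_left x hx (s i) (hs i) (hlt i)
  · simpa using h.expand_right x hx (s i) (hs i) (hxs.resolve_left hlt i)

/-- Left of the minimum only the `inl` half is active, right of the maximum only the `inr` half.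
Openness of `I` leaves an interval on each side, and each half spans there. -/
lemma IsPacketSystem.eq_zero_of_sideCoeff {I : Set ℝ} (hI : IsOpen I) {K : ℝ → ℝ → ℝ}
    {H : Fin m ⊕ Fin m → ℝ → ℝ} {α β : ℝ → Fin m → ℝ} (h : IsPacketSystem I K H α β) {n : ℕ}
    (hn : 0 < n) {s : Fin n → ℝ} (hs : ∀ i, s i ∈ I) {γ : Fin m ⊕ Fin m → ℝ}
    (hγ : ∀ x ∈ {x | x ∈ I ∧ ((∀ i, x < s i) ∨ ∀ i, s i < x)},
      ∑ k, γ k * sideCoeff α β s x k = 0) : γ = 0 := by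
  have : Nonempty (Fin n) := ⟨⟨0, hn⟩⟩
  obtain ⟨p, hp⟩ := Finite.exists_min s
  obtain ⟨q, hq⟩ := Finite.exists_max s
  obtain ⟨a, b, hap, hpb, hab⟩ := exists_Ioo_subset hI (hs p)
  obtain ⟨a', b', hap', hpb', hab'⟩ := exists_Ioo_subset hI (hs q)
  have hJ : Ioo a (s p) ⊆ I := (Ioo_subset_Ioo_right hpb.le).trans hab
  have hJ' : Ioo (s q) b' ⊆ I := (Ioo_subset_Ioo_left hap'.le).trans hab'
  have h1 := h.span_left a (s p) hap hJ (fun k => γ (Sum.inl k)) fun x hx => by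
    have hlt : ∀ i, x < s i := fun i => hx.2.trans_le (hp i)
    have := hγ x ⟨hJ hx, Or.inl hlt⟩
    simpa [sideCoeff, hlt, Fintype.sum_sum_type] using this
  have h2 := h.span_right (s q) b' hpb' hJ' (fun k => γ (Sum.inr k)) fun x hx => by
    have hlt : ∀ i, s i < x := fun i => (hq i).trans_lt hx.1
    have hnlt : ¬ ∀ i, x < s i := fun h => lt_asymm (h p) (hlt p)
    have := hγ x ⟨hJ' hx, Or.inr hlt⟩
    rw [sideCoeff, if_neg hnlt] at this
    simpa [Fintype.sum_sum_type] using this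
  funext k
  rcases k with k | k
  · exact congrFun h1 k
  · exact congrFun h2 k

/-- The coefficients of the packets that vanish on the outer set are the solutions of the system. -/
theorem vanishesOutside_iff (hI : ∀ d, IsOpen (I d))
    (hK : ∀ d, IsPacketSystem (I d) (K d) (H d) (α d) (β d)) {n : ℕ} (hn : 0 < n)
    {t : Fin n → Fin D → ℝ} (ht : ∀ i, t i ∈ domainBox I) {a : Fin n → ℝ} :
    VanishesOutside I K t a ↔ SolvesSystem (tensorFn H) t a := by
  have hpacket : ∀ x ∈ outerSet I t, packet K t a x = ∑ k : Fin D → Fin m ⊕ Fin m,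
      (∑ i, a i * tensorFn H (t i) k) *
        ∏ d, sideCoeff (α d) (β d) (fun i => t i d) (x d) (k d) := by
    intro x hx
    -- In each direction `x` lies on one side of all points, so the same coefficients serve every
    -- `i`.
    have h1 : ∀ i, productKernel K x (t i) = ∑ k : Fin D → Fin m ⊕ Fin m,
        ∏ d, sideCoeff (α d) (β d) (fun i => t i d) (x d) (k d) * H d (k d) (t i d) := by
      intro i
      rw [productKernel, Finset.prod_congr rfl fun d _ =>
        (hK d).eq_sum_sideCoeff (fun i => ht i d) (hx.1 d) (hx.2 d) i, Finset.prod_univ_sum,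
        Fintype.piFinset_univ]
    simp only [packet, h1, Finset.mul_sum, Finset.sum_mul]
    rw [Finset.sum_comm]
    refine Finset.sum_congr rfl fun k _ => Finset.sum_congr rfl fun i _ => ?_
    rw [Finset.prod_mul_distrib, tensorFn]
    ring
  rw [solvesSystem_iff]
  constructor
  · intro hv
    refine congrFun (eq_zero_of_tensor (fun d x => sideCoeff (α d) (β d) (fun i => t i d) x)
      (fun d γ hγ => (hK d).eq_zero_of_sideCoeff (hI d) hn (fun i => ht i d) hγ)
      (fun k => ∑ i, a i * tensorFn H (t i) k) fun x hx => ?_)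
    have hx' : x ∈ outerSet I t := ⟨fun d => (hx d).1, fun d => (hx d).2⟩
    rw [← hpacket x hx']
    exact hv x hx'
  · intro hs x hx
    rw [hpacket x hx]
    simp [hs]

/-- Sections of product kernels at distinct points are linearly independent. -/
theorem exists_packet_ne_zero (hK : ∀ d, IsPacketSystem (I d) (K d) (H d) (α d) (β d)) {n : ℕ}
    {t : Fin n → Fin D → ℝ} (hinj : Function.Injective t) (ht : ∀ i, t i ∈ domainBox I)
    {a : Fin n → ℝ} (ha : a ≠ 0) : ∃ x ∈ domainBox I, packet K t a x ≠ 0 := by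
  classical
  by_contra! hcon
  refine ha (funext fun i₀ => ?_)
  -- Embed the points in the grid of their coordinates and extend the coefficients by zero; the Gram
  -- matrix on the grid is a tensor product of nonsingular ones.
  set S : Fin D → Finset ℝ := fun d => Finset.univ.image fun i => t i d with hS
  have hSI : ∀ d, ∀ s ∈ S d, s ∈ I d := by
    intro d s hs
    obtain ⟨i, -, rfl⟩ := Finset.mem_image.1 hs
    exact ht i d
  set pt : Fin n → ∀ d, S d :=
    fun i d => ⟨t i d, Finset.mem_image_of_mem _ (Finset.mem_univ i)⟩ with hpt
  have hptinj : Function.Injective pt := fun i j hij =>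
    hinj (funext fun d => congrArg Subtype.val (congrFun hij d))
  have hb := eq_zero_of_tensor (κ := fun d => S d) (A := fun d => (S d : Set ℝ))
    (fun d x s => K d x s) (fun d γ hγ => ?_)
    (fun k => ∑ i, if pt i = k then a i else 0) fun x hx => ?_
  · have := congrFun hb (pt i₀)
    simpa [hptinj.eq_iff] using this
  · funext s
    have h1 := (hK d).posDef (S d) (fun s => if h : s ∈ S d then γ ⟨s, h⟩ else 0) (hSI d)
      (fun x hx => by
        rw [← Finset.sum_coe_sort, ← hγ x hx]
        exact Finset.sum_congr rfl fun s _ => by simp) s s.2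
    simpa using h1
  · have hx' : x ∈ domainBox I := fun d => hSI d _ (hx d)
    refine Eq.trans ?_ (hcon x hx')
    simp only [Finset.sum_mul, packet]
    rw [Finset.sum_comm]
    refine Finset.sum_congr rfl fun i _ => ?_
    rw [Fintype.sum_eq_single (pt i) fun k hk => by simp [hk.symm]]
    simp [hpt, productKernel]

lemma isOpen_domainBox (hI : ∀ d, IsOpen (I d)) : IsOpen (domainBox I) := by
  simp only [domainBox, ofPred_forall]
  exact isOpen_iInter_of_finite fun d => (hI d).preimage (continuous_apply d)

lemma continuousOn_tensorFn (hK : ∀ d, IsPacketSystem (I d) (K d) (H d) (α d) (β d))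
    (k : Fin D → Fin m ⊕ Fin m) : ContinuousOn (fun x => tensorFn H x k) (domainBox I) :=
  continuousOn_finsetProd _ fun d _ =>
    ((hK d).continuousOn (k d)).comp (continuous_apply d).continuousOn fun _ hx => hx d

lemma isLocallySeparating_tensorFn (hK : ∀ d, IsPacketSystem (I d) (K d) (H d) (α d) (β d))
    {M : ℕ} (e : Fin M ≃ (Fin D → Fin m ⊕ Fin m)) :
    IsLocallySeparating (domainBox I) fun x j => tensorFn H x (e j) := by
  intro O hOI hO hne γ hγ
  obtain ⟨x, hx⟩ := hne
  obtain ⟨ε, hε, hball⟩ := Metric.isOpen_iff.1 hO x hx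
  have hbox : ∀ z : Fin D → ℝ, (∀ d, z d ∈ Ioo (x d - ε) (x d + ε)) → z ∈ O := fun z hz => by
    refine hball ((dist_pi_lt_iff hε).2 fun d => ?_)
    have := hz d
    rw [← Real.ball_eq_Ioo] at this
    exact this
  have hJ : ∀ d, Ioo (x d - ε) (x d + ε) ⊆ I d := by
    intro d u hu
    have := hOI (hbox (Function.update x d u) fun d' => ?_) d
    · simpa using this
    · rcases eq_or_ne d' d with rfl | hne
      · simpa using hu
      · rw [Function.update_of_ne hne]
        exact ⟨by linarith, by linarith⟩
  have h0 := eq_zero_of_tensor (A := fun d => Ioo (x d - ε) (x d + ε)) (fun d u k => H d k u)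
    (fun d γ hγ => (hK d).linearIndependent _ _ (by linarith) (hJ d) γ hγ) (γ ∘ e.symm)
    fun z hz => by
      rw [← hγ z (hbox z hz), ← e.sum_comp]
      simp [tensorFn]
  funext j
  simpa using congrFun h0 (e j)

lemma solvesSystem_comp_equiv_iff {M n : ℕ} (e : Fin M ≃ (Fin D → Fin m ⊕ Fin m))
    {t : Fin n → Fin D → ℝ} {a : Fin n → ℝ} :
    SolvesSystem (fun x j => tensorFn H x (e j)) t a ↔ SolvesSystem (tensorFn H) t a := by
  rw [solvesSystem_iff, solvesSystem_iff]
  exact ⟨fun h k => by simpa using h (e.symm k), fun h j => h _⟩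

lemma exists_ne_zero_solvesSystem {N n : ℕ} (h : N < n) (G : (Fin D → ℝ) → Fin N → ℝ)
    (t : Fin n → Fin D → ℝ) : ∃ a, a ≠ 0 ∧ SolvesSystem G t a := by
  have hker := LinearMap.ker_ne_bot_of_finrank_lt
    (f := Fintype.linearCombination ℝ (fun i => G (t i))) (by simpa using h)
  obtain ⟨a, ha, ha0⟩ := (Submodule.ne_bot_iff _).1 hker
  exact ⟨a, ha0, by simpa [Fintype.linearCombination_apply, SolvesSystem] using ha⟩

/-- With `N < n` equations one point can be discarded; its zero coefficient is what contradicts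
general position. -/
lemma exists_ne_zero_solvesSystem_of_eq_zero {N n : ℕ} (h : N < n)
    (G : (Fin D → ℝ) → Fin N → ℝ) (t : Fin (n + 1) → Fin D → ℝ) :
    ∃ a, a ≠ 0 ∧ SolvesSystem G t a ∧ a 0 = 0 := by
  obtain ⟨a, ha, hs⟩ := exists_ne_zero_solvesSystem h G (fun i => t i.succ)
  refine ⟨Fin.cons 0 a, fun h => ha ?_, ?_, rfl⟩
  · funext i
    simpa using congrFun h i.succ
  · rw [SolvesSystem, Fin.sum_univ_succ]
    simpa [SolvesSystem] using hs

end Packets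

end KernelPacket

end

/-! ### Existence, characterization and minimality of kernel packets. -/

theorem mainTheorem10 {D m : ℕ} (hD : 1 ≤ D) (hm : 1 ≤ m)
    (t₀ T : Fin D → EReal) (hT : ∀ d, t₀ d < T d)
    (I : Fin D → Set ℝ) (hI : ∀ d, I d = KernelPacket.timeInterval (t₀ d) (T d))
    {Ω : Fin D → Type*} [∀ d, MeasurableSpace (Ω d)]
    (P : (d : Fin D) → Measure (Ω d)) [∀ d, IsProbabilityMeasure (P d)]
    (c : Fin D → Fin m → ℝ → ℝ) (hc : ∀ d i, ContinuousOn (c d i) (I d))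
    (W y : (d : Fin D) → ℝ → Ω d → ℝ)
    (hy : ∀ d, KernelPacket.IsForwardSolution (I d) (c d) (P d) (W d) (y d))
    (K : Fin D → ℝ → ℝ → ℝ) (hK : ∀ d, K d = KernelPacket.kernel (P d) (y d))
    (ψ ζ : Fin D → Fin m → ℝ → ℝ)
    (hψ : ∀ d, KernelPacket.IsFundamentalSystem (I d) (c d) (ψ d))
    (hζ : ∀ d, KernelPacket.IsFundamentalSystem (I d)
      (KernelPacket.backwardCoeff (c d) (P d) (y d)) (ζ d)) :
    -- every configuration of `(2m)^D + 1` distinct points carries a kernel packet, and the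
    -- solutions of the system are exactly the coefficients of kernel packets
    (∀ t : Fin ((2 * m) ^ D + 1) → Fin D → ℝ, Function.Injective t →
      (∀ i, t i ∈ KernelPacket.domainBox I) →
        (∃ a, a ≠ 0 ∧ KernelPacket.SolvesSystem (KernelPacket.tensorVec ψ ζ) t a) ∧
        (∀ a, KernelPacket.SolvesSystem (KernelPacket.tensorVec ψ ζ) t a →
          KernelPacket.VanishesOutside I K t a) ∧
        (∀ a, KernelPacket.VanishesOutside I K t a →
          KernelPacket.SolvesSystem (KernelPacket.tensorVec ψ ζ) t a) ∧
        (∀ a, a ≠ 0 → ∃ x ∈ KernelPacket.domainBox I, KernelPacket.packet K t a x ≠ 0)) ∧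
    -- minimality: the number of points cannot be lowered
    IsLeast {n : ℕ | ∀ t : Fin n → Fin D → ℝ, Function.Injective t →
      (∀ i, t i ∈ KernelPacket.domainBox I) →
        ∃ a, a ≠ 0 ∧ KernelPacket.VanishesOutside I K t a} ((2 * m) ^ D + 1) ∧
    -- minimality: no system with fewer equations yields kernel packets
    (∀ (N : ℕ) (G : (Fin D → ℝ) → Fin N → ℝ),
      (∀ t : Fin ((2 * m) ^ D + 1) → Fin D → ℝ, Function.Injective t →
        (∀ i, t i ∈ KernelPacket.domainBox I) →
          ∀ a, KernelPacket.SolvesSystem G t a → KernelPacket.VanishesOutside I K t a) →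
      (2 * m) ^ D ≤ N) ∧
    -- minimality: for an open dense set of configurations the kernel packet is unique up to a
    -- factor and irreducible (no nontrivial combination over a proper subset of the points
    -- vanishes on `U`)
    (∃ V : Set (Fin ((2 * m) ^ D + 1) → Fin D → ℝ), IsOpen V ∧
      {t | ∀ i, t i ∈ KernelPacket.domainBox I} ⊆ closure V ∧
      ∀ t ∈ V, (∀ i, t i ∈ KernelPacket.domainBox I) →
        (∀ a b, KernelPacket.VanishesOutside I K t a → a ≠ 0 →
          KernelPacket.VanishesOutside I K t b → ∃ r : ℝ, b = r • a) ∧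
        (∀ a, KernelPacket.VanishesOutside I K t a → (∃ i, a i = 0) → a = 0)) := by
  open KernelPacket in
  have hIo : ∀ d, IsOpen (I d) := fun d => hI d ▸ isOpen_timeInterval _ _
  have hS : ∀ d, IsPacketSystem (I d) (K d) (Sum.elim (ψ d) (ζ d)) _ _ := fun d =>
    hK d ▸ (hy d).isPacketSystem hm (hIo d) (hI d ▸ ordConnected_timeInterval _ _) (hc d) (hψ d)
      (hζ d)
  rw [tensorVec_eq_tensorFn]
  obtain ⟨e⟩ : Nonempty (Fin ((2 * m) ^ D) ≃ (Fin D → Fin m ⊕ Fin m)) :=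
    ⟨(Fintype.equivFinOfCardEq (by simp [two_mul])).symm⟩
  set H : Fin D → Fin m ⊕ Fin m → ℝ → ℝ := fun d => Sum.elim (ψ d) (ζ d) with hH
  set F : (Fin D → ℝ) → Fin ((2 * m) ^ D) → ℝ := fun x j => tensorFn H x (e j) with hF
  have hM : 2 ≤ (2 * m) ^ D := (by omega : 2 ≤ 2 * m).trans (Nat.le_self_pow (by omega) _)
  have hiff : ∀ {n : ℕ}, 0 < n → ∀ {t : Fin n → Fin D → ℝ}, (∀ i, t i ∈ domainBox I) →
      ∀ {a : Fin n → ℝ}, VanishesOutside I K t a ↔ SolvesSystem F t a := fun hn _ ht _ =>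
    (vanishesOutside_iff hIo hS hn ht).trans (solvesSystem_comp_equiv_iff e).symm
  have hbox := isOpen_domainBox hIo
  have hFc : ContinuousOn F (domainBox I) :=
    continuousOn_pi.2 fun j => continuousOn_tensorFn hS (e j)
  have hsep : IsLocallySeparating (domainBox I) F := isLocallySeparating_tensorFn hS e
  have hclosure := hsep.subset_closure hbox hFc
  have hne : (generalSet (domainBox I) F).Nonempty := by
    choose x hx using fun d => nonempty_timeInterval (hT d)
    rw [← closure_nonempty_iff]
    exact ⟨fun _ => x, hclosure fun _ d => hI d ▸ hx d⟩
  have hzero : ∀ t ∈ generalSet (domainBox I) F, ∀ a, VanishesOutside I K t a →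
      ∀ i, a i = 0 → a = 0 := fun t ht a ha i hi =>
    eq_zero_of_mem_generalSet ht ((hiff (Nat.succ_pos _) ht.1).1 ha) hi
  refine ⟨fun t hinj ht => ⟨?_, ?_, ?_, ?_⟩, ⟨?_, ?_⟩, ?_, generalSet (domainBox I) F,
    isOpen_generalSet hbox hFc, hclosure, fun t ht _ => ⟨?_, ?_⟩⟩
  · obtain ⟨a, ha, hs⟩ := exists_ne_zero_solvesSystem (Nat.lt_succ_self _) F t
    exact ⟨a, ha, (solvesSystem_comp_equiv_iff e).1 hs⟩
  · exact fun a => (vanishesOutside_iff hIo hS (Nat.succ_pos _) ht).2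
  · exact fun a => (vanishesOutside_iff hIo hS (Nat.succ_pos _) ht).1
  · exact fun a => exists_packet_ne_zero hS hinj ht
  · intro t _ ht
    obtain ⟨a, ha, hs⟩ := exists_ne_zero_solvesSystem (Nat.lt_succ_self _) F t
    exact ⟨a, ha, (hiff (Nat.succ_pos _) ht).2 hs⟩
  · intro n hn
    by_contra! hlt
    obtain ⟨t, ht⟩ := hne
    have hι : Function.Injective (Fin.castLE hlt.le) := Fin.castLE_injective _
    obtain ⟨a, ha, hv⟩ := hn (t ∘ Fin.castLE hlt.le)
      ((injective_of_mem_generalSet hM ht).comp hι) fun i => ht.1 _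
    have hn0 : 0 < n := by
      rcases Nat.eq_zero_or_pos n with rfl | h
      · exact (ha (Subsingleton.elim _ _)).elim
      · exact h
    have hs := (hiff hn0 fun i => ht.1 _).1 hv
    -- A packet on the first `n` points, padded with zeros, solves the full system. Since `n <
    -- (2m)^D + 1`, its last coefficient is zero.
    have hext : ∑ i, Function.extend (Fin.castLE hlt.le) a 0 i • F (t i) = 0 := by
      rw [← hs]
      refine (Fintype.sum_of_injective _ hι _ _ (fun i hi => ?_) fun i => ?_).symm
      · rw [Function.extend_apply' _ _ _ hi, Pi.zero_apply, zero_smul]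
      · rw [hι.extend_apply]
    have hlast : Function.extend (Fin.castLE hlt.le) a 0 (Fin.last _) = 0 := by
      rw [Function.extend_apply' _ _ _ ?_, Pi.zero_apply]
      rintro ⟨i, hi⟩
      have := congrArg Fin.val hi
      simp only [Fin.val_castLE, Fin.val_last] at this
      omega
    have h0 := eq_zero_of_mem_generalSet ht hext hlast
    refine ha (funext fun i => ?_)
    rw [← hι.extend_apply a 0 i, h0]
    rfl
  · intro N G hG
    by_contra! hlt
    obtain ⟨t, ht⟩ := hne
    obtain ⟨a, ha, hs, h0⟩ := exists_ne_zero_solvesSystem_of_eq_zero hlt G t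
    exact ha (hzero t ht a (hG t (injective_of_mem_generalSet hM ht) ht.1 a hs) 0 h0)
  · intro a b ha ha0 hb
    have h0 : a 0 ≠ 0 := fun h => ha0 (hzero t ht a ha 0 h)
    -- This ratio makes coefficient `0` of `b - r • a` vanish, which forces the whole difference to
    -- vanish.
    refine ⟨b 0 / a 0, ?_⟩
    rw [hiff (Nat.succ_pos _) ht.1] at ha hb
    have hs : ∑ i, (b - (b 0 / a 0) • a) i • F (t i) = 0 := by
      simp only [Pi.sub_apply, Pi.smul_apply, sub_smul, smul_assoc, Finset.sum_sub_distrib,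
        ← Finset.smul_sum]
      rw [show ∑ i, b i • F (t i) = 0 from hb, show ∑ i, a i • F (t i) = 0 from ha, smul_zero,
        sub_zero]
    exact sub_eq_zero.1 (eq_zero_of_mem_generalSet ht hs (i₀ := 0) (by simp [h0]))
  · rintro a ha ⟨i, hi⟩
    exact hzero t ht a ha i hi
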